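/- \textbf{Theorem (Chen-type inequality).} Let $(M,g)$ be a smooth $m$-dimensional Riemannian manifold, $m>2$, with Levi-Civita connection $\nabla$, and let $J$ be a smooth $g$-symmetric $(1,1)$-tensor field on $M$ with $J^2=pJ+qI$, where $p,q\in\mathbb R$ and $p^2+4q>0$. Put $\sigma_\pm=\frac{p\pm\sqrt{p^2+4q}}2$ and let $$\mathcal P=\frac{\sigma_+I-J}{\sqrt{p^2+4q}},\qquad \mathcal P'=\frac{J-\sigma_-I}{\sqrt{p^2+4q}},\qquad \mathcal D=\ker\mathcal P' ,$$ so that $\mathcal P,\mathcal P'$ are the orthogonal projections onto $\mathcal D$ and $\mathcal D^\perp=\ker\mathcal P$. Let $a,b,c\in\mathbb R$ with $qa^2-pab-b^2=1$, put $F=aJ+bI$, and assume that the Riemann curvature tensor $R(X,Y,Z,W)=g(\nabla_X\nabla_YZ-\nabla_Y\nabla_XZ-\nabla_{[X,Y]}Z,W)$ of $M$ is $$R(X,Y,Z,W)=c\,[g(X,FW)g(Y,FZ)-g(X,FZ)g(Y,FW)]$$ for all smooth vector fields $X,Y,Z,W$. Assume that $\mathcal D$ has constant rank $n$ with $2\le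 n<m$ and that $\mathcal D$ is integrable (that is, involutive: $[X,Y]\in\Gamma(\mathcal D)$ for $X,Y\in\Gamma(\mathcal D)$). Let $h(X,Y)=\mathcal P'(\nabla_XY)$ for $X,Y\in\Gamma(\mathcal D)$, let $H=\frac1n\operatorname{tr}h$ be the mean curvature, and let $R^{\mathcal D}$ be the curvature tensor of the induced connection $\nabla^{\mathcal D}_XY=\mathcal P(\nabla_XY)$ on $\mathcal D$. Let $K^{\mathcal D}(X,Y)=R^{\mathcal D}(X,Y,Y,X)/(g(X,X)g(Y,Y)-g(X,Y)^2)$ be the sectional curvature of $\mathcal D$, and let $\tau^{\mathcal D}=\sum_{i<j}K^{\mathcal D}(e_i,e_j)$, for an orthonormal basis $(e_i)$ of $\mathcal D_x$, be the scalar curvature of $\mathcal D$. Let $\delta_{\mathcal D}=\tau^{\mathcal D}-\inf K^{\mathcal D}$ be the Chen first invariant, where at each point $x$ the infimum is over the $2$-planes in $\mathcal D_x$. Then at every point of $M$ $$\delta_{\mathcal D}\le\frac{c(a\sigma_-+b)^2(n^2-n+2)}2+\frac{n^2(n-2)}{2(n-1)}\|H\|^2 .$$ -/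

import Mathlib

open Bundle
open scoped Manifold ContDiff

noncomputable section

namespace MetallicChen

section Defs

variable {E : Type*} [NormedAddCommGroup E] [NormedSpace ℝ E] [FiniteDimensional ℝ E]
  {H : Type*} [TopologicalSpace H] {I : ModelWithCorners ℝ E H}
  {M : Type*} [TopologicalSpace M] [ChartedSpace H M] [IsManifold I ∞ M]

/-- The vector field `X` on `M` is smooth. -/
def SmoothField (X : Π x : M, TangentSpace I x) : Prop :=
  ContMDiff I I.tangent ∞ (fun x => (⟨x, X x⟩ : TangentBundle I M))

/-- The field of endomorphisms `J` of `TM` (a `(1,1)`-tensor field) is smooth. -/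
def SmoothEndo (J : Π x : M, TangentSpace I x →L[ℝ] TangentSpace I x) : Prop :=
  ContMDiff I (I.prod 𝓘(ℝ, E →L[ℝ] E)) ∞
    (fun x => TotalSpace.mk' (E →L[ℝ] E)
      (E := fun x : M => TangentSpace I x →L[ℝ] TangentSpace I x) x (J x))

/-- The curvature `R(X, Y)Z = ∇_X ∇_Y Z - ∇_Y ∇_X Z - ∇_[X, Y] Z` at `x` of an operator `D`
assigning to `Z` and `x` the linear map `u ↦ (∇_u Z)(x)`. -/
def curvature (D : (Π x : M, TangentSpace I x) → Π x : M, TangentSpace I x →L[ℝ] TangentSpace I x)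
    (X Y Z : Π x : M, TangentSpace I x) (x : M) : TangentSpace I x :=
  D (fun y => D Z y (Y y)) x (X x) - D (fun y => D Z y (X y)) x (Y x)
    - D Z x (VectorField.mlieBracket I X Y x)

/-- `σ₊ = (p + √(p² + 4q)) / 2`. -/
def sigmaPlus (p q : ℝ) : ℝ := (p + √(p ^ 2 + 4 * q)) / 2

/-- `σ₋ = (p - √(p² + 4q)) / 2`. -/
def sigmaMinus (p q : ℝ) : ℝ := (p - √(p ^ 2 + 4 * q)) / 2

/-- `𝒫 = -(1/√(p² + 4q)) J + (σ₊/√(p² + 4q)) I`. -/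
def projP (p q : ℝ) (J : Π x : M, TangentSpace I x →L[ℝ] TangentSpace I x) (x : M) :
    TangentSpace I x →L[ℝ] TangentSpace I x :=
  -(1 / √(p ^ 2 + 4 * q)) • J x
    + (sigmaPlus p q / √(p ^ 2 + 4 * q)) • ContinuousLinearMap.id ℝ (TangentSpace I x)

/-- `𝒫' = (1/√(p² + 4q)) J - (σ₋/√(p² + 4q)) I`. -/
def projP' (p q : ℝ) (J : Π x : M, TangentSpace I x →L[ℝ] TangentSpace I x) (x : M) :
    TangentSpace I x →L[ℝ] TangentSpace I x :=
  (1 / √(p ^ 2 + 4 * q)) • J x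
    - (sigmaMinus p q / √(p ^ 2 + 4 * q)) • ContinuousLinearMap.id ℝ (TangentSpace I x)

/-- The metallic distribution `𝒟 = ker 𝒫'`. -/
def distD (p q : ℝ) (J : Π x : M, TangentSpace I x →L[ℝ] TangentSpace I x) (x : M) :
    Submodule ℝ (TangentSpace I x) :=
  LinearMap.ker (projP' p q J x).toLinearMap

/-- Integrability of a distribution, in the involutive form: the bracket of two smooth sections
is again a section. -/
def IsIntegrable (D : Π x : M, Submodule ℝ (TangentSpace I x)) : Prop :=
  ∀ X Y : Π x : M, TangentSpace I x, SmoothField X → SmoothField Y →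
    (∀ x, X x ∈ D x) → (∀ x, Y x ∈ D x) → ∀ x, VectorField.mlieBracket I X Y x ∈ D x

/-- The local section of `𝒟` near `x` with value `v` at `x`, for `v ∈ 𝒟 x`: the projection
to `𝒟` of a local extension of `v` to a vector field. -/
def extendD (p q : ℝ) (J : Π x : M, TangentSpace I x →L[ℝ] TangentSpace I x) {x : M}
    (v : TangentSpace I x) : Π y : M, TangentSpace I y :=
  fun y => projP p q J y (FiberBundle.extend E v y)

variable [RiemannianBundle (fun x : M => TangentSpace I x)]
  [IsContMDiffRiemannianBundle I ∞ E (fun x : M => TangentSpace I x)]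

/-- `(J, g)` is a metallic Riemannian structure with `J² = pJ + qI`. -/
structure IsMetallicRiemannian (p q : ℝ)
    (J : Π x : M, TangentSpace I x →L[ℝ] TangentSpace I x) : Prop where
  smooth : SmoothEndo J
  sq : ∀ (x : M) (v : TangentSpace I x), J x (J x v) = p • J x v + q • v
  symm : ∀ (x : M) (v w : TangentSpace I x), inner ℝ (J x v) w = inner ℝ v (J x w)

/-- `∇` is the Levi-Civita connection of the metric: the (smooth) linear connection that is
torsion-free and compatible with the metric, `u g(Y, Z) = g(∇_u Y, Z) + g(Y, ∇_u Z)`. In Mathlib's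
argument order, `nabla Y x u` is `∇_u Y` at `x`. -/
structure IsLeviCivita (nabla : CovariantDerivative I E (fun x : M => TangentSpace I x)) :
    Prop where
  smooth : ContMDiffCovariantDerivativeOn E ∞ nabla.toFun Set.univ
  torsionFree : nabla.torsion = 0
  metric : ∀ (Y Z : Π x : M, TangentSpace I x) (x : M), MDiffAt (T% Y) x → MDiffAt (T% Z) x →
    ∀ u : TangentSpace I x, d% (fun y => inner ℝ (Y y) (Z y)) x u
      = inner ℝ (nabla Y x u) (Z x) + inner ℝ (Y x) (nabla Z x u)

/-- The ambient `(0,4)` curvature `R^M(X, Y, Z, W) = g(R(X, Y)Z, W)` at `x`. -/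
def riemannM (nabla : CovariantDerivative I E (fun x : M => TangentSpace I x))
    (X Y Z W : Π x : M, TangentSpace I x) (x : M) : ℝ :=
  inner ℝ (curvature nabla.toFun X Y Z x) (W x)

/-- The induced connection on `𝒟`: `∇^𝒟_u Y = 𝒫 (∇_u Y)` for sections `Y` of `𝒟`. -/
def inducedConn (p q : ℝ) (J : Π x : M, TangentSpace I x →L[ℝ] TangentSpace I x)
    (nabla : CovariantDerivative I E (fun x : M => TangentSpace I x))
    (Y : Π x : M, TangentSpace I x) (x : M) : TangentSpace I x →L[ℝ] TangentSpace I x :=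
  projP p q J x ∘L nabla Y x

/-- The intrinsic `(0,4)` curvature `R^𝒟(u, v, w, z)` of `𝒟` at `x`, for `u, v, w, z ∈ 𝒟 x`,
computed with the induced connection on local sections of `𝒟` through `u, v, w`. -/
def riemannD (p q : ℝ) (J : Π x : M, TangentSpace I x →L[ℝ] TangentSpace I x)
    (nabla : CovariantDerivative I E (fun x : M => TangentSpace I x)) (x : M)
    (u v w z : TangentSpace I x) : ℝ :=
  inner ℝ (curvature (inducedConn p q J nabla)
    (extendD p q J u) (extendD p q J v) (extendD p q J w) x) z

/-- The sectional curvature `K^𝒟` of the plane spanned by two independent vectors `u, v ∈ 𝒟 x`. -/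
def sectionalD (p q : ℝ) (J : Π x : M, TangentSpace I x →L[ℝ] TangentSpace I x)
    (nabla : CovariantDerivative I E (fun x : M => TangentSpace I x)) (x : M)
    (u v : TangentSpace I x) : ℝ :=
  riemannD p q J nabla x u v v u
    / (inner ℝ u u * inner ℝ v v - inner ℝ u v ^ 2)

/-- The scalar curvature `τ^𝒟 = ½ ∑ᵢⱼ R^𝒟(eᵢ, eⱼ, eⱼ, eᵢ) = ∑_{i<j} K^𝒟(eᵢ, eⱼ)` at `x`, for an
orthonormal basis `e` of `𝒟 x`. -/
def scalarD (p q : ℝ) (J : Π x : M, TangentSpace I x →L[ℝ] TangentSpace I x)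
    (nabla : CovariantDerivative I E (fun x : M => TangentSpace I x)) (x : M) : ℝ :=
  haveI : FiniteDimensional ℝ (TangentSpace I x) := inferInstanceAs (FiniteDimensional ℝ E)
  let e := stdOrthonormalBasis ℝ (distD p q J x)
  (1 / 2) * ∑ i, ∑ j, riemannD p q J nabla x (e i) (e j) (e j) (e i)

/-- The Chen first invariant `δ_𝒟 = τ^𝒟 - inf K^𝒟` at `x`, the infimum being over the planes
contained in `𝒟 x`. -/
def chenInvariant (p q : ℝ) (J : Π x : M, TangentSpace I x →L[ℝ] TangentSpace I x)
    (nabla : CovariantDerivative I E (fun x : M => TangentSpace I x)) (x : M) : ℝ :=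
  scalarD p q J nabla x
    - sInf {k : ℝ | ∃ u ∈ distD p q J x, ∃ v ∈ distD p q J x,
        LinearIndependent ℝ ![u, v] ∧ k = sectionalD p q J nabla x u v}

/-- The second fundamental form `h(u, v) = 𝒫' (∇_u v)` of `𝒟` at `x`, for `u, v ∈ 𝒟 x`. -/
def secondFF (p q : ℝ) (J : Π x : M, TangentSpace I x →L[ℝ] TangentSpace I x)
    (nabla : CovariantDerivative I E (fun x : M => TangentSpace I x)) (x : M)
    (u v : TangentSpace I x) : TangentSpace I x :=
  projP' p q J x (nabla (extendD p q J v) x u)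

/-- The mean curvature `H = (1/n) tr h` of `𝒟` at `x`, where `n = dim 𝒟 x`. -/
def meanCurvature (p q : ℝ) (J : Π x : M, TangentSpace I x →L[ℝ] TangentSpace I x)
    (nabla : CovariantDerivative I E (fun x : M => TangentSpace I x)) (x : M) :
    TangentSpace I x :=
  haveI : FiniteDimensional ℝ (TangentSpace I x) := inferInstanceAs (FiniteDimensional ℝ E)
  let e := stdOrthonormalBasis ℝ (distD p q J x)
  (1 / (Module.finrank ℝ (distD p q J x) : ℝ)) • ∑ i, secondFF p q J nabla x (e i) (e i)

end Defs

end MetallicChen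

end

/-!
On `𝒟 = ker 𝒫'` the structure `J` acts as `σ₋`, so `F` acts there as `l = a σ₋ + b`, and on the
orthogonal complement as `k = a σ₊ + b`; the relation between `a` and `b` says `l k = -1`. The
ambient curvature restricted to `𝒟` is therefore that of a space of constant curvature
`κ = c l²`, and the Gauss equation (`riemannD_eq`) expresses the curvature of `𝒟` through `κ` and
the second fundamental form, which is symmetric because `𝒟` is involutive. Chen's algebraic argument
(`chen_algebraic`) then gives
`δ_𝒟 ≤ κ (n² - n - 2) / 2 + n² (n - 2) / (2 (n - 1)) ‖H‖²`.
Its core is the Cauchy–Schwarz inequality for the `n - 1` vectors `h₁₁ + h₂₂, h₃₃, …, hₙₙ`.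

The claimed constant `n² - n + 2` is weaker exactly when `κ ≥ 0`, so `c ≥ 0` has to be proved; this
is `nonneg_of_curv_eq`. The curvature has the shape of the Gauss equation of a hypersurface with
shape operator `F`, and so the second Bianchi identity becomes an algebraic identity for the
defect `(∇_X F)Y - (∇_Y F)X` of the Codazzi equation (`bianchi_codazziDefect`). For two sections
`X, Y` of `𝒟` and one section `U` of `𝒟^⊥` it forces `𝒟^⊥` to be autoparallel
(`inner_cov_normal_eq_zero`) and the second fundamental form of `𝒟` to be trace-free on every plane
(`trace_cov_normal`). If `X, Y` are orthonormal at a point, the sum of the curvatures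
`g(R(X, U)U, X) + g(R(Y, U)U, Y)` equals `-2 c |U|²` by the hypothesis on `R`, because `l k = -1`,
while the Riccati equation, whose derivative term is controlled by differentiating the trace
identity, evaluates it as minus a sum of squares.

Everything is done with global smooth vector fields: bump functions extend every germ of a vector
field, so that pointwise identities can be tested on global fields, and the local sections which
define the curvature of `𝒟` may be replaced by global ones.
-/

noncomputable section

namespace MetallicChen

open VectorField Filter
open scoped Topology

/-! ### Smooth vector fields and the second Bianchi identity -/

section Fields

variable {E : Type*} [NormedAddCommGroup E] [NormedSpace ℝ E]
  {H : Type*} [TopologicalSpace H] {I : ModelWithCorners ℝ E H}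
  {M : Type*} [TopologicalSpace M] [ChartedSpace H M] [IsManifold I ∞ M]

variable (I M) in
/-- The real vector space of smooth vector fields on `M`. -/
abbrev VField : Type _ := ContMDiffSection I E ∞ (TangentSpace I : M → Type _)

lemma VField.mdiffAt (X : VField I M) (x : M) : MDiffAt (T% (fun y => X y)) x :=
  X.contMDiff.mdifferentiableAt (by simp)

/-- A smooth field of endomorphisms applied to a smooth vector field. -/
def applyEndo {A : Π x : M, TangentSpace I x →L[ℝ] TangentSpace I x} (hA : SmoothEndo A)
    (X : VField I M) : VField I M :=
  ⟨fun x => A x (X x), hA.clm_bundle_apply X.contMDiff⟩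

@[simp] lemma applyEndo_apply {A : Π x : M, TangentSpace I x →L[ℝ] TangentSpace I x}
    (hA : SmoothEndo A) (X : VField I M) (x : M) : applyEndo hA X x = A x (X x) := rfl

set_option linter.unusedSectionVars false

variable [FiniteDimensional ℝ E]

/-- Multiplication by a bump function turns the local extension of a vector into a global smooth
vector field. -/
lemma exists_field_eventuallyEq_extend [T2Space M] {x : M} (v : TangentSpace I x) :
    ∃ X : VField I M, ∀ᶠ y in 𝓝 x, X y = FiberBundle.extend E v y := by
  obtain ⟨s, hs, hsm⟩ := FiberBundle.exists_contMDiffOn_extend (k := ∞) I E v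
  obtain ⟨u, hus, hu, hxu⟩ := mem_nhds_iff.1 hs
  obtain ⟨f, -, hf⟩ := (SmoothBumpFunction.nhds_basis_tsupport (I := I) x).mem_iff.1
    (hu.mem_nhds hxu)
  refine ⟨⟨(f : M → ℝ) • FiberBundle.extend E v, ContMDiffOn.smul_section_of_tsupport
    f.contMDiff.contMDiffOn hu hf (hsm.mono hus)⟩, ?_⟩
  filter_upwards [f.eventuallyEq_one] with y hy
  change f y • (FiberBundle.extend E v y : TangentSpace I y) = _
  rw [hy]; simp

/-- The Lie bracket of smooth vector fields. -/
def bracket (X Y : VField I M) : VField I M :=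
  ⟨mlieBracket I X Y, by
    have : IsManifold I (∞ + 1) M := inferInstanceAs (IsManifold I ∞ M)
    have : IsManifold I (minSmoothness ℝ 2) M := by simpa using inferInstanceAs (IsManifold I 2 M)
    exact ContDiff.mlieBracket_vectorField (m := ⊤) (n := ⊤) X.contMDiff Y.contMDiff (by simp)⟩

lemma bracket_swap (X Y : VField I M) : bracket X Y = -bracket Y X :=
  ContMDiffSection.coe_injective (mlieBracket_swap (V := X) (W := Y))

lemma bracket_jacobi (X Y Z : VField I M) :
    bracket X (bracket Y Z) = bracket (bracket X Y) Z + bracket Y (bracket X Z) := by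
  have : IsManifold I (minSmoothness ℝ 3) M := by simpa using inferInstanceAs (IsManifold I 3 M)
  have h (W : VField I M) : CMDiff (minSmoothness ℝ 2) (T% (fun y => W y)) :=
    W.contMDiff.of_le (by
      rw [minSmoothness_of_isRCLikeNormedField]; exact WithTop.coe_le_coe.2 le_top)
  exact ContMDiffSection.coe_injective (leibniz_identity_mlieBracket (h X) (h Y) (h Z))

variable [RiemannianBundle (fun x : M => TangentSpace I x)]
  [IsContMDiffRiemannianBundle I ∞ E (fun x : M => TangentSpace I x)]
  {nabla : CovariantDerivative I E (fun x : M => TangentSpace I x)}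

/-- The covariant derivative `∇_X Y` of smooth vector fields. -/
def cov (hnabla : IsLeviCivita nabla) (X Y : VField I M) : VField I M :=
  ⟨fun x => nabla Y x (X x), by
    have h := hnabla.smooth.contMDiff (σ := Y) Y.contMDiff.contMDiffOn
    exact (contMDiffOn_univ.1 h).clm_bundle_apply X.contMDiff⟩

variable (hnabla : IsLeviCivita nabla)

@[simp] lemma cov_apply (X Y : VField I M) (x : M) : cov hnabla X Y x = nabla Y x (X x) := rfl

lemma cov_add_left (X X' Y : VField I M) :
    cov hnabla (X + X') Y = cov hnabla X Y + cov hnabla X' Y := by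
  ext x; exact (nabla Y x).map_add _ _

lemma cov_neg_left (X Y : VField I M) : cov hnabla (-X) Y = -cov hnabla X Y := by
  ext x; exact (nabla Y x).map_neg _

lemma cov_add_right (X Y Y' : VField I M) :
    cov hnabla X (Y + Y') = cov hnabla X Y + cov hnabla X Y' := by
  ext x
  exact congrArg (fun L => L (X x))
    (nabla.isCovariantDerivativeOnUniv.add (Y.mdiffAt x) (Y'.mdiffAt x))

lemma cov_smul_right (r : ℝ) (X Y : VField I M) :
    cov hnabla X (r • Y) = r • cov hnabla X Y := by
  ext x
  exact congrArg (fun L => L (X x))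
    (nabla.isCovariantDerivativeOnUniv.smul_const r (Y.mdiffAt x))

lemma cov_neg_right (X Y : VField I M) : cov hnabla X (-Y) = -cov hnabla X Y := by
  have h := cov_smul_right hnabla (-1) X Y
  rwa [neg_one_smul, neg_one_smul] at h

lemma cov_sub_right (X Y Y' : VField I M) :
    cov hnabla X (Y - Y') = cov hnabla X Y - cov hnabla X Y' := by
  rw [sub_eq_add_neg, cov_add_right, cov_neg_right, sub_eq_add_neg]

lemma bracket_eq (X Y : VField I M) :
    bracket X Y = cov hnabla X Y - cov hnabla Y X := by
  ext x
  exact ((CovariantDerivative.torsion_eq_zero_iff nabla).1 hnabla.torsionFree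
    (X.mdiffAt x) (Y.mdiffAt x)).symm

lemma bracket_neg_left (hnabla : IsLeviCivita nabla) (X Y : VField I M) :
    bracket (-X) Y = -bracket X Y := by
  rw [bracket_eq hnabla, bracket_eq hnabla, cov_neg_left, cov_neg_right]
  abel

/-- The curvature `R(X, Y)Z` of smooth vector fields. -/
def curv (X Y Z : VField I M) : VField I M :=
  cov hnabla X (cov hnabla Y Z) - cov hnabla Y (cov hnabla X Z) - cov hnabla (bracket X Y) Z

/-- The second Bianchi identity, in the form of the Jacobi identity for the operators `∇_X`. -/
lemma second_bianchi (X Y Z W : VField I M) :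
    (cov hnabla X (curv hnabla Y Z W) - curv hnabla Y Z (cov hnabla X W)
        - curv hnabla (bracket X Y) Z W)
      + (cov hnabla Y (curv hnabla Z X W) - curv hnabla Z X (cov hnabla Y W)
        - curv hnabla (bracket Y Z) X W)
      + (cov hnabla Z (curv hnabla X Y W) - curv hnabla X Y (cov hnabla Z W)
        - curv hnabla (bracket Z X) Y W) = 0 := by
  have hJ : bracket (bracket X Y) Z + bracket (bracket Y Z) X + bracket (bracket Z X) Y = 0 := by
    have h := bracket_jacobi X Y Z
    rw [bracket_swap X (bracket Y Z), bracket_swap Y (bracket X Z), bracket_swap X Z,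
      bracket_neg_left hnabla, neg_neg] at h
    rw [add_right_comm, ← h, neg_add_cancel]
  have hJ' : cov hnabla (bracket (bracket X Y) Z) W + cov hnabla (bracket (bracket Y Z) X) W
      + cov hnabla (bracket (bracket Z X) Y) W = 0 := by
    rw [← cov_add_left, ← cov_add_left, hJ]
    ext x; exact (nabla W x).map_zero
  simp only [curv, cov_sub_right]
  rw [← hJ']
  abel

end Fields

/-! ### The metric and the Codazzi defect -/

section Metric

set_option linter.unusedSectionVars false

variable {E : Type*} [NormedAddCommGroup E] [NormedSpace ℝ E] [FiniteDimensional ℝ E]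
  {H : Type*} [TopologicalSpace H] {I : ModelWithCorners ℝ E H}
  {M : Type*} [TopologicalSpace M] [ChartedSpace H M] [IsManifold I ∞ M]
  [RiemannianBundle (fun x : M => TangentSpace I x)]
  [IsContMDiffRiemannianBundle I ∞ E (fun x : M => TangentSpace I x)]
  {nabla : CovariantDerivative I E (fun x : M => TangentSpace I x)}

/-- The function `g(X, Y)` on `M`. -/
def metricFun (X Y : VField I M) (x : M) : ℝ := inner ℝ (X x) (Y x)

lemma contMDiff_metricFun (X Y : VField I M) : CMDiff ∞ (metricFun X Y) :=
  ContMDiff.inner_bundle X.contMDiff Y.contMDiff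

lemma mdiffAt_metricFun (X Y : VField I M) (x : M) : MDiffAt (metricFun X Y) x :=
  (contMDiff_metricFun X Y).mdifferentiableAt (by simp)

/-- The product `g(X, Y) Z`, as a smooth vector field. -/
def metricSMul (X Y Z : VField I M) : VField I M :=
  ⟨metricFun X Y • (Z : Π x : M, TangentSpace I x),
    (contMDiff_metricFun X Y).smul_section Z.contMDiff⟩

variable (hnabla : IsLeviCivita nabla)

lemma mvfderiv_metricFun (X Y Z : VField I M) (x : M) :
    d% (metricFun Y Z) x (X x)
      = inner ℝ (cov hnabla X Y x) (Z x) + inner ℝ (Y x) (cov hnabla X Z x) :=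
  hnabla.metric Y Z x (Y.mdiffAt x) (Z.mdiffAt x) (X x)

lemma cov_metricSMul (X Y Z W : VField I M) (x : M) :
    cov hnabla X (metricSMul Y Z W) x = (inner ℝ (Y x) (Z x) : ℝ) • cov hnabla X W x
      + (inner ℝ (cov hnabla X Y x) (Z x) + inner ℝ (Y x) (cov hnabla X Z x) : ℝ) • W x := by
  rw [← mvfderiv_metricFun]
  exact congrArg (fun L => L (X x))
    (nabla.isCovariantDerivativeOnUniv.leibniz (W.mdiffAt x) (mdiffAt_metricFun Y Z x))

/-- The Codazzi defect `(∇_X F)Y - (∇_Y F)X` of a field of endomorphisms. -/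
def codazziDefect {F : Π x : M, TangentSpace I x →L[ℝ] TangentSpace I x} (hF : SmoothEndo F)
    (X Y : VField I M) : VField I M :=
  cov hnabla X (applyEndo hF Y) - cov hnabla Y (applyEndo hF X) - applyEndo hF (bracket X Y)

/-- If the curvature is that of a hypersurface with shape operator `F` (up to the factor `c`),
then the second Bianchi identity says that the cyclic sum of `FZ ∧ ((∇_X F)Y - (∇_Y F)X)`
vanishes. -/
lemma bianchi_codazziDefect {F : Π x : M, TangentSpace I x →L[ℝ] TangentSpace I x}
    (hF : SmoothEndo F) (c : ℝ)
    (hR : ∀ X Y Z : VField I M, ∀ x, curv hnabla X Y Z x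
      = c • ((inner ℝ (F x (Y x)) (Z x) : ℝ) • F x (X x)
          - (inner ℝ (F x (X x)) (Z x) : ℝ) • F x (Y x)))
    (X Y Z W : VField I M) (x : M) :
    c • (((inner ℝ (F x (Z x)) (W x) : ℝ) • codazziDefect hnabla hF X Y x
        - (inner ℝ (codazziDefect hnabla hF X Y x) (W x) : ℝ) • F x (Z x))
      + ((inner ℝ (F x (X x)) (W x) : ℝ) • codazziDefect hnabla hF Y Z x
        - (inner ℝ (codazziDefect hnabla hF Y Z x) (W x) : ℝ) • F x (X x))
      + ((inner ℝ (F x (Y x)) (W x) : ℝ) • codazziDefect hnabla hF Z X x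
        - (inner ℝ (codazziDefect hnabla hF Z X x) (W x) : ℝ) • F x (Y x))) = 0 := by
  have hR' (X Y Z : VField I M) : curv hnabla X Y Z
      = c • (metricSMul (applyEndo hF Y) Z (applyEndo hF X)
        - metricSMul (applyEndo hF X) Z (applyEndo hF Y)) := by
    ext x; exact hR X Y Z x
  have key (X Y Z : VField I M) : (cov hnabla X (curv hnabla Y Z W)
        - curv hnabla Y Z (cov hnabla X W) - curv hnabla (bracket X Y) Z W) x
      = c • ((inner ℝ (F x (Z x)) (W x) : ℝ) •
          (cov hnabla X (applyEndo hF Y) x - F x (bracket X Y x))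
        + (inner ℝ (cov hnabla X (applyEndo hF Z) x) (W x) : ℝ) • F x (Y x)
        - (inner ℝ (F x (Y x)) (W x) : ℝ) • cov hnabla X (applyEndo hF Z) x
        - (inner ℝ (cov hnabla X (applyEndo hF Y) x - F x (bracket X Y x)) (W x) : ℝ)
          • F x (Z x)) := by
    rw [ContMDiffSection.coe_sub, ContMDiffSection.coe_sub, Pi.sub_apply, Pi.sub_apply,
      hR, hR, hR' Y Z W, cov_smul_right, cov_sub_right]
    rw [ContMDiffSection.coe_smul, Pi.smul_apply, ContMDiffSection.coe_sub, Pi.sub_apply,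
      cov_metricSMul, cov_metricSMul]
    simp only [applyEndo_apply, inner_sub_left]
    module
  have hB := congrArg (fun V : VField I M => V x) (second_bianchi hnabla X Y Z W)
  simp only [ContMDiffSection.coe_add, Pi.add_apply, key] at hB
  refine Eq.trans ?_ hB
  simp only [codazziDefect, ContMDiffSection.coe_sub, Pi.sub_apply, applyEndo_apply,
    inner_sub_left]
  module

end Metric

/-! ### Orthogonal splittings of the tangent bundle -/

section Projection

set_option linter.unusedSectionVars false

variable {E : Type*} [NormedAddCommGroup E] [NormedSpace ℝ E] [FiniteDimensional ℝ E]
  {H : Type*} [TopologicalSpace H] {I : ModelWithCorners ℝ E H}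
  {M : Type*} [TopologicalSpace M] [ChartedSpace H M] [IsManifold I ∞ M]
  [RiemannianBundle (fun x : M => TangentSpace I x)]
  [IsContMDiffRiemannianBundle I ∞ E (fun x : M => TangentSpace I x)]
  {nabla : CovariantDerivative I E (fun x : M => TangentSpace I x)}
  {P F : Π x : M, TangentSpace I x →L[ℝ] TangentSpace I x}

/-- A smooth field of orthogonal projections of the tangent spaces; it encodes the orthogonal
splitting of `TM` into the distributions `{v | P v = v}` and `{v | P v = 0}`. -/
structure IsProjectionField (P : Π x : M, TangentSpace I x →L[ℝ] TangentSpace I x) : Prop where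
  smooth : SmoothEndo P
  idem : ∀ (x : M) (v : TangentSpace I x), P x (P x v) = P x v
  symm : ∀ (x : M) (v w : TangentSpace I x), inner ℝ (P x v) w = inner ℝ v (P x w)

/-- The vector field `X` is a section of the image of `P`. -/
def IsTangent (P : Π x : M, TangentSpace I x →L[ℝ] TangentSpace I x) (X : VField I M) : Prop :=
  ∀ y, P y (X y) = X y

/-- The vector field `U` is a section of the kernel of `P`. -/
def IsNormal (P : Π x : M, TangentSpace I x →L[ℝ] TangentSpace I x) (U : VField I M) : Prop :=
  ∀ y, P y (U y) = 0

/-- The image of `P` is involutive. -/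
def IsInvolutive (P : Π x : M, TangentSpace I x →L[ℝ] TangentSpace I x) : Prop :=
  ∀ X Y : VField I M, IsTangent P X → IsTangent P Y → IsTangent P (bracket X Y)

lemma exists_field [T2Space M] {x : M} (v : TangentSpace I x) : ∃ X : VField I M, X x = v := by
  obtain ⟨X, hX⟩ := exists_field_eventuallyEq_extend v
  exact ⟨X, by simpa using hX.self_of_nhds⟩

namespace IsProjectionField

lemma inner_eq_zero (hP : IsProjectionField P) {x : M} {v w : TangentSpace I x}
    (hv : P x v = v) (hw : P x w = 0) : (inner ℝ v w : ℝ) = 0 := by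
  rw [← hv, hP.symm, hw, inner_zero_right]

lemma inner_eq_zero' (hP : IsProjectionField P) {x : M} {v w : TangentSpace I x}
    (hv : P x v = 0) (hw : P x w = w) : (inner ℝ v w : ℝ) = 0 := by
  rw [← hw, ← hP.symm, hv, inner_zero_left]

lemma exists_tangent [T2Space M] (hP : IsProjectionField P) {x : M} {v : TangentSpace I x}
    (hv : P x v = v) : ∃ X : VField I M, IsTangent P X ∧ X x = v := by
  obtain ⟨X, hX⟩ := exists_field v
  exact ⟨applyEndo hP.smooth X, fun y => hP.idem y _, by simp [hX, hv]⟩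

lemma exists_normal [T2Space M] (hP : IsProjectionField P) {x : M} {v : TangentSpace I x}
    (hv : P x v = 0) : ∃ X : VField I M, IsNormal P X ∧ X x = v := by
  obtain ⟨X, hX⟩ := exists_field v
  refine ⟨X - applyEndo hP.smooth X, fun y => ?_, ?_⟩
  · rw [ContMDiffSection.coe_sub, Pi.sub_apply, map_sub, applyEndo_apply, hP.idem, sub_self]
  · rw [ContMDiffSection.coe_sub, Pi.sub_apply, applyEndo_apply, hX, hv, sub_zero]

/-- For sections of the two complementary distributions, the derivative of `g(X, U) = 0`. -/
lemma inner_cov_normal (hP : IsProjectionField P) (hnabla : IsLeviCivita nabla)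
    {X U : VField I M} (hX : IsTangent P X) (hU : IsNormal P U) (x : M) (v : TangentSpace I x) :
    (inner ℝ (nabla U x v) (X x) : ℝ) = -inner ℝ (nabla X x v) (U x) := by
  have h0 : (fun y => inner ℝ (U y) (X y) : M → ℝ) = fun _ => 0 := by
    ext y; exact hP.inner_eq_zero' (hU y) (hX y)
  have h := hnabla.metric U X x (U.mdiffAt x) (X.mdiffAt x) v
  rw [h0, mvfderiv_const, real_inner_comm (nabla X x v)] at h
  rw [eq_neg_iff_add_eq_zero]
  exact h.symm

/-- The second fundamental form of an involutive distribution is symmetric. -/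
lemma inner_cov_symm [T2Space M] (hP : IsProjectionField P) (hnabla : IsLeviCivita nabla)
    (hinv : IsInvolutive P) {U : VField I M} (hU : IsNormal P U) {x : M}
    {v w : TangentSpace I x} (hv : P x v = v) (hw : P x w = w) :
    (inner ℝ (nabla U x v) w : ℝ) = inner ℝ (nabla U x w) v := by
  obtain ⟨X, hX, rfl⟩ := hP.exists_tangent hv
  obtain ⟨Y, hY, rfl⟩ := hP.exists_tangent hw
  rw [hP.inner_cov_normal hnabla hY hU, hP.inner_cov_normal hnabla hX hU, neg_inj, ← sub_eq_zero,
    ← inner_sub_left]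
  have h := hP.inner_eq_zero (hinv X Y hX hY x) (hU x)
  rw [bracket_eq hnabla] at h
  exact h

end IsProjectionField

section Curvature

variable [T2Space M] (hP : IsProjectionField P) (hnabla : IsLeviCivita nabla)
  (hinv : IsInvolutive P) (hF : SmoothEndo F) {c l k : ℝ}
  (hFP : ∀ (x : M) (v : TangentSpace I x), F x v = l • P x v + k • (v - P x v))
  (hlk : l * k = -1) (hc : c ≠ 0)
  (hR : ∀ X Y Z : VField I M, ∀ x, curv hnabla X Y Z x
      = c • ((inner ℝ (F x (Y x)) (Z x) : ℝ) • F x (X x)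
          - (inner ℝ (F x (X x)) (Z x) : ℝ) • F x (Y x)))

include hFP in
lemma codazziDefect_tangent (hinv : IsInvolutive P) {X Y : VField I M}
    (hX : IsTangent P X) (hY : IsTangent P Y) : codazziDefect hnabla hF X Y = 0 := by
  have h {Z : VField I M} (hZ : IsTangent P Z) : applyEndo hF Z = l • Z := by
    ext y
    change F y (Z y) = l • Z y
    rw [hFP, hZ y, sub_self, smul_zero, add_zero]
  rw [codazziDefect, h hX, h hY, h (hinv X Y hX hY), cov_smul_right, cov_smul_right,
    bracket_eq hnabla, smul_sub, sub_self]

include hFP in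
/-- The tangential part of the mixed Codazzi defect sees `∇_Y U`, the normal part `∇_U Y`. -/
lemma codazziDefect_mixed {Y U : VField I M}
    (hY : IsTangent P Y) (hU : IsNormal P U) (x : M) : codazziDefect hnabla hF Y U x
      = (k - l) • (P x (nabla U x (Y x)) + (nabla Y x (U x) - P x (nabla Y x (U x)))) := by
  have h1 : applyEndo hF Y = l • Y := by
    ext y
    change F y (Y y) = l • Y y
    rw [hFP, hY y, sub_self, smul_zero, add_zero]
  have h2 : applyEndo hF U = k • U := by
    ext y
    change F y (U y) = k • U y
    rw [hFP, hU y, smul_zero, zero_add, sub_zero]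
  rw [codazziDefect, h1, h2, cov_smul_right, cov_smul_right, bracket_eq hnabla]
  change k • nabla U x (Y x) - l • nabla Y x (U x) - F x (nabla U x (Y x) - nabla Y x (U x)) = _
  rw [hFP, map_sub]
  module

lemma codazziDefect_swap (X Y : VField I M) :
    codazziDefect hnabla hF X Y = -codazziDefect hnabla hF Y X := by
  rw [codazziDefect, codazziDefect, bracket_swap]
  ext y
  change _ - F y (-(bracket Y X y)) = -(_ - F y (bracket Y X y))
  rw [map_neg, ContMDiffSection.coe_sub, ContMDiffSection.coe_sub]
  simp only [Pi.sub_apply]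
  abel

include hP hinv hF hFP hlk hc hR

/-- The second Bianchi identity for two sections `X`, `Y` of the image of `P` and a section `U` of
its kernel, in terms of `T Y = P ∇_Y U + (1 - P) ∇_U Y`. -/
lemma bianchi_mixed {X Y U : VField I M} (hX : IsTangent P X) (hY : IsTangent P Y)
    (hU : IsNormal P U) {x : M} (w : TangentSpace I x) :
    letI T (Y : VField I M) : TangentSpace I x :=
      P x (nabla U x (Y x)) + (nabla Y x (U x) - P x (nabla Y x (U x)))
    (inner ℝ (X x) w : ℝ) • T Y - (inner ℝ (T Y) w : ℝ) • X x
      = (inner ℝ (Y x) w : ℝ) • T X - (inner ℝ (T X) w : ℝ) • Y x := by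
  obtain ⟨W, rfl⟩ := exists_field w
  have hl : l ≠ 0 := by rintro rfl; simp at hlk
  have hkl : k - l ≠ 0 := by
    intro h
    rw [sub_eq_zero.1 h] at hlk
    nlinarith [mul_self_nonneg l]
  have h := bianchi_codazziDefect hnabla hF c hR X Y U W x
  have hFX {Z : VField I M} (hZ : IsTangent P Z) : F x (Z x) = l • Z x := by
    rw [hFP, hZ x, sub_self, smul_zero, add_zero]
  rw [codazziDefect_tangent hnabla hF hFP hinv hX hY, codazziDefect_swap hnabla hF U X,
    ContMDiffSection.coe_neg, Pi.neg_apply,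
    codazziDefect_mixed hnabla hF hFP hX hU, codazziDefect_mixed hnabla hF hFP hY hU,
    hFX hX, hFX hY, ContMDiffSection.coe_zero, Pi.zero_apply] at h
  simp only [inner_neg_left, inner_smul_left, inner_zero_left, RCLike.conj_to_real] at h
  rw [← sub_eq_zero]
  refine (smul_eq_zero_iff_right (mul_ne_zero hc (mul_ne_zero hl hkl))).1 (Eq.trans ?_ h)
  module

end Curvature
end Projection

/-! ### The sign of the constant `c` -/

section CurvatureSign

set_option linter.unusedSectionVars false

variable {E : Type*} [NormedAddCommGroup E] [NormedSpace ℝ E] [FiniteDimensional ℝ E]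
  {H : Type*} [TopologicalSpace H] {I : ModelWithCorners ℝ E H}
  {M : Type*} [TopologicalSpace M] [ChartedSpace H M] [IsManifold I ∞ M]
  [RiemannianBundle (fun x : M => TangentSpace I x)]
  [IsContMDiffRiemannianBundle I ∞ E (fun x : M => TangentSpace I x)]
  {nabla : CovariantDerivative I E (fun x : M => TangentSpace I x)}
  {P F : Π x : M, TangentSpace I x →L[ℝ] TangentSpace I x}
  [T2Space M] (hP : IsProjectionField P) (hnabla : IsLeviCivita nabla)
  (hinv : IsInvolutive P) (hF : SmoothEndo F) {c l k : ℝ}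
  (hFP : ∀ (x : M) (v : TangentSpace I x), F x v = l • P x v + k • (v - P x v))
  (hlk : l * k = -1) (hc : c ≠ 0)
  (hR : ∀ X Y Z : VField I M, ∀ x, curv hnabla X Y Z x
      = c • ((inner ℝ (F x (Y x)) (Z x) : ℝ) • F x (X x)
          - (inner ℝ (F x (X x)) (Z x) : ℝ) • F x (Y x)))

include hP hnabla hinv hF hFP hlk hc hR

/-- The kernel of `P` is autoparallel, provided the image of `P` has dimension at least two. -/
lemma inner_cov_normal_eq_zero {U : VField I M} (hU : IsNormal P U) {x : M}
    {u v w : TangentSpace I x} (hu : P x u = 0) (hw : P x w = w)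
    (hv : P x v = v) (hv0 : v ≠ 0) (hvw : (inner ℝ v w : ℝ) = 0) :
    (inner ℝ (nabla U x u) w : ℝ) = 0 := by
  obtain ⟨X, hX, rfl⟩ := hP.exists_tangent hv
  obtain ⟨Y, hY, rfl⟩ := hP.exists_tangent hw
  obtain ⟨V, hV, rfl⟩ := hP.exists_normal hu
  have h := bianchi_mixed hP hnabla hinv hF hFP hlk hc hR hX hY hV (X x)
  simp only [real_inner_comm (X x) (Y x), hvw, zero_smul, zero_sub] at h
  have h2 := congrArg (fun z => (inner ℝ z (U x) : ℝ)) h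
  simp only [inner_sub_left, inner_neg_left, inner_smul_left, inner_add_left,
    hP.inner_eq_zero (hP.idem x _) (hU x), hP.inner_eq_zero (hX x) (hU x),
    hP.inner_eq_zero (hY x) (hU x), RCLike.conj_to_real, mul_zero, sub_zero, zero_add,
    neg_zero] at h2
  rw [hP.inner_cov_normal hnabla hY hU, neg_eq_zero]
  exact (mul_eq_zero.1 h2).resolve_left (by simpa using hv0)

/-- The part of `bianchi_mixed` tangent to the image of `P`. -/
lemma inner_bianchi_mixed {X Y U : VField I M} (hX : IsTangent P X) (hY : IsTangent P Y)
    (hU : IsNormal P U) {x : M} (w : TangentSpace I x) {z : TangentSpace I x} (hz : P x z = z)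
    (hw : P x w = w) :
    (inner ℝ (X x) w * inner ℝ (nabla U x (Y x)) z - inner ℝ (nabla U x (Y x)) w * inner ℝ (X x) z
      : ℝ) = inner ℝ (Y x) w * inner ℝ (nabla U x (X x)) z
        - inner ℝ (nabla U x (X x)) w * inner ℝ (Y x) z := by
  have hT (v u : TangentSpace I x) {z : TangentSpace I x} (hz : P x z = z) :
      (inner ℝ (P x v + (u - P x u)) z : ℝ) = inner ℝ v z := by
    rw [inner_add_left, inner_sub_left, hP.symm, hP.symm, hz, sub_self, add_zero]
  have h := congrArg (fun v => (inner ℝ v z : ℝ))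
    (bianchi_mixed hP hnabla hinv hF hFP hlk hc hR hX hY hU w)
  simpa only [inner_sub_left, inner_smul_left, RCLike.conj_to_real, hT _ _ hz, hT _ _ hw]
    using h

/-- The second fundamental form in a normal direction has vanishing trace on the plane spanned by two
sections `X`, `Y` of the image of `P`; the trace is scaled by the Gram determinant, so that the
identity holds at every point, for sections that need not be orthonormal or independent. -/
lemma trace_cov_normal {X Y U : VField I M} (hX : IsTangent P X) (hY : IsTangent P Y)
    (hU : IsNormal P U) : metricFun X X * metricFun (cov hnabla Y U) Y
      + metricFun Y Y * metricFun (cov hnabla X U) X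
      - metricFun X Y * (metricFun (cov hnabla X U) Y + metricFun (cov hnabla Y U) X) = 0 := by
  ext x
  have h := inner_bianchi_mixed hP hnabla hinv hF hFP hlk hc hR hX hY hU (X x) (hY x) (hX x)
  simp only [Pi.add_apply, Pi.mul_apply, Pi.sub_apply, metricFun, cov_apply, Pi.zero_apply]
  rw [real_inner_comm (X x) (Y x)] at h
  linear_combination h

/-- The Riccati equation, traced over an orthonormal pair in the image of `P`, shows that the
mixed curvature `-c` is nonpositive. -/
lemma nonneg_of_curv_eq
    (h2 : ∀ (x : M) (w : TangentSpace I x), P x w = w →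
      ∃ v : TangentSpace I x, P x v = v ∧ v ≠ 0 ∧ (inner ℝ v w : ℝ) = 0)
    {x : M} {v w u : TangentSpace I x} (hv : P x v = v) (hw : P x w = w) (hu : P x u = 0)
    (hvv : (inner ℝ v v : ℝ) = 1) (hww : (inner ℝ w w : ℝ) = 1) (hvw : (inner ℝ v w : ℝ) = 0)
    (hu0 : u ≠ 0) : 0 ≤ c := by
  obtain ⟨X, hX, rfl⟩ := hP.exists_tangent hv
  obtain ⟨Y, hY, rfl⟩ := hP.exists_tangent hw
  obtain ⟨U, hU, rfl⟩ := hP.exists_normal hu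
  have auto {U : VField I M} (hU : IsNormal P U) {y : M} {u z : TangentSpace I y}
      (hu : P y u = 0) (hz : P y z = z) : (inner ℝ (nabla U y u) z : ℝ) = 0 := by
    obtain ⟨v, hv, hv0, hvz⟩ := h2 y z hz
    exact inner_cov_normal_eq_zero hP hnabla hinv hF hFP hlk hc hR hU hu hz hv hv0 hvz
  -- the kernel of `P` is autoparallel, so `∇_U U` is again normal
  have hN : IsNormal P (cov hnabla U U) := fun y => by
    rw [← inner_self_eq_zero (𝕜 := ℝ), hP.symm, hP.idem]
    exact auto hU (hU y) (hP.idem y _)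
  -- dually, `∇_U` preserves sections of the image of `P`
  have tan {Z : VField I M} (hZ : IsTangent P Z) : P x (nabla Z x (U x)) = nabla Z x (U x) := by
    rw [← sub_eq_zero, ← inner_self_eq_zero (𝕜 := ℝ)]
    have h1 : P x (P x (nabla Z x (U x)) - nabla Z x (U x)) = 0 := by
      rw [map_sub, hP.idem, sub_self]
    obtain ⟨V, hV, hVx⟩ := hP.exists_normal h1
    nth_rw 2 [← hVx]
    rw [inner_sub_left, hP.inner_eq_zero (hP.idem x _) (hV x), zero_sub,
      ← hP.inner_cov_normal hnabla hZ hV]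
    exact auto hV (hU x) (hZ x)
  -- the curvature of the plane spanned by a tangent field `Z` and `U`
  have ric {Z : VField I M} (hZ : IsTangent P Z) (hZ1 : (inner ℝ (Z x) (Z x) : ℝ) = 1) :
      -c * inner ℝ (U x) (U x) = inner ℝ (nabla (cov hnabla U U) x (Z x)) (Z x)
        - d% (metricFun (cov hnabla Z U) Z) x (U x)
        + 2 * inner ℝ (nabla U x (Z x)) (nabla Z x (U x))
        - inner ℝ (P x (nabla U x (Z x))) (P x (nabla U x (Z x))) := by
    have hK : inner ℝ (curv hnabla Z U U x) (Z x) = -c * (inner ℝ (U x) (U x) : ℝ) := by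
      rw [hR, hFP, hFP, hZ x, hU x]
      simp only [sub_self, smul_zero, add_zero, sub_zero, zero_add, inner_smul_left,
        inner_sub_left, hP.inner_eq_zero (hZ x) (hU x), hP.inner_eq_zero' (hU x) (hZ x),
        RCLike.conj_to_real, hZ1]
      linear_combination (c * inner ℝ (U x) (U x)) * hlk
    have hd := mvfderiv_metricFun hnabla U (cov hnabla Z U) Z x
    rw [← hK, hd, curv, bracket_eq hnabla]
    change inner ℝ (nabla (cov hnabla U U) x (Z x) - nabla (cov hnabla Z U) x (U x)
      - nabla U x (nabla U x (Z x) - nabla Z x (U x))) (Z x) = _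
    have e1 : (inner ℝ (nabla U x (nabla U x (Z x))) (Z x) : ℝ)
        = inner ℝ (P x (nabla U x (Z x))) (P x (nabla U x (Z x))) := by
      have h0 := auto hU (u := nabla U x (Z x) - P x (nabla U x (Z x)))
        (by rw [map_sub, hP.idem, sub_self]) (hZ x)
      rw [map_sub, inner_sub_left, sub_eq_zero] at h0
      rw [h0, hP.inner_cov_symm hnabla hinv hU (hP.idem x _) (hZ x), hP.symm, hP.idem]
    have e2 : (inner ℝ (nabla U x (nabla Z x (U x))) (Z x) : ℝ)
        = inner ℝ (nabla U x (Z x)) (nabla Z x (U x)) :=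
      hP.inner_cov_symm hnabla hinv hU (tan hZ) (hZ x)
    rw [map_sub, inner_sub_left, inner_sub_left, inner_sub_left, e1, e2]
    simp only [cov_apply]
    ring
  have hRX := ric hX hvv
  have hRY := ric hY hww
  -- `tr ∇N = 0` on the plane, for the normal field `N = ∇_U U`
  have htr := congrFun (trace_cov_normal hP hnabla hinv hF hFP hlk hc hR hX hY hN) x
  simp only [Pi.add_apply, Pi.mul_apply, Pi.sub_apply, metricFun, cov_apply, Pi.zero_apply,
    hvv, hww, hvw] at htr
  -- the derivative along `U` of the trace identity
  have hQ := trace_cov_normal hP hnabla hinv hF hFP hlk hc hR hX hY hU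
  have hQ' := congrArg (fun L => L (U x)) (congrArg (fun f : M → ℝ => d% f x) hQ)
  have md (A B : VField I M) : MDiffAt (metricFun A B) x := mdiffAt_metricFun A B x
  simp only [mvfderiv_zero] at hQ'
  rw [mvfderiv_sub (((md _ _).mul (md _ _)).add ((md _ _).mul (md _ _)))
      ((md _ _).mul ((md _ _).add (md _ _))),
    mvfderiv_add ((md _ _).mul (md _ _)) ((md _ _).mul (md _ _)),
    mvfderiv_mul (md _ _) (md _ _), mvfderiv_mul (md _ _) (md _ _),
    mvfderiv_mul (md _ _) ((md _ _).add (md _ _))] at hQ'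
  simp only [sub_apply, add_apply, smul_apply, smul_eq_mul, Pi.add_apply] at hQ'
  rw [mvfderiv_metricFun hnabla U X X, mvfderiv_metricFun hnabla U Y Y,
    mvfderiv_metricFun hnabla U X Y] at hQ'
  simp only [metricFun, cov_apply, hvv, hww, hvw] at hQ'
  -- the derivatives `∇_U X`, `∇_U Y` only enter through their components along `X` and `Y`
  have hBX := inner_bianchi_mixed hP hnabla hinv hF hFP hlk hc hR hX hY hU (Y x) (tan hX) hw
  have hBY := inner_bianchi_mixed hP hnabla hinv hF hFP hlk hc hR hX hY hU (X x) (tan hY) hv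
  have hsym := hP.inner_cov_symm hnabla hinv hU hv hw
  rw [hww, hvw] at hBX
  rw [hvv, real_inner_comm (X x) (Y x), hvw] at hBY
  simp only [real_inner_comm (nabla X x (U x)) (X x), real_inner_comm (nabla X x (U x)) (Y x),
    real_inner_comm (nabla Y x (U x)) (X x), real_inner_comm (nabla Y x (U x)) (Y x)]
    at hBX hBY hQ'
  rw [hsym] at hQ' hBX
  have hmain : 2 * c * (inner ℝ (U x) (U x) : ℝ)
      = inner ℝ (P x (nabla U x (X x))) (P x (nabla U x (X x)))
        + inner ℝ (P x (nabla U x (Y x))) (P x (nabla U x (Y x))) := by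
    simp only [zero_apply] at hQ'
    linear_combination -hRX - hRY - htr + hQ' + 2 * hBX - 2 * hBY
  have hU0 : 0 < (inner ℝ (U x) (U x) : ℝ) := real_inner_self_pos.2 hu0
  have h1 := real_inner_self_nonneg (x := P x (nabla U x (X x)))
  have h3 := real_inner_self_nonneg (x := P x (nabla U x (Y x)))
  by_contra hneg
  nlinarith [mul_pos_of_neg_of_neg (not_le.1 hneg) (neg_lt_zero.2 hU0)]

end CurvatureSign

/-! ### Chen's inequality for algebraic curvature tensors -/

section LinearAlgebra

variable {D V W : Type*} [NormedAddCommGroup D] [InnerProductSpace ℝ D]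
  [NormedAddCommGroup V] [InnerProductSpace ℝ V] [AddCommGroup W] [Module ℝ W]

/-- The trace of a vector-valued bilinear form does not depend on the orthonormal basis. -/
lemma sum_bilin_orthonormalBasis {ι ι' : Type*} [Fintype ι] [Fintype ι']
    (e : OrthonormalBasis ι ℝ D) (f : OrthonormalBasis ι' ℝ D) (L : D →ₗ[ℝ] D →ₗ[ℝ] W) :
    ∑ i, L (e i) (e i) = ∑ j, L (f j) (f j) := by
  classical
  have h (i : ι) : L (e i) (e i)
      = ∑ j, ∑ k, ((inner ℝ (f j) (e i) : ℝ) * inner ℝ (e i) (f k)) • L (f j) (f k) := by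
    conv_lhs => rw [← f.sum_repr' (e i)]
    simp only [map_sum, map_smul, LinearMap.sum_apply, LinearMap.smul_apply, smul_smul,
      Finset.smul_sum]
    rw [Finset.sum_comm]
    refine Finset.sum_congr rfl fun j _ => Finset.sum_congr rfl fun k _ => ?_
    rw [real_inner_comm (f k) (e i), mul_comm]
  rw [Finset.sum_congr rfl fun i _ => h i, Finset.sum_comm]
  refine Finset.sum_congr rfl fun j _ => ?_
  rw [Finset.sum_comm]
  simp only [← Finset.sum_smul, e.sum_inner_mul_inner, f.inner_eq_ite, ite_smul, one_smul,
    zero_smul, Finset.sum_ite_eq, Finset.mem_univ, if_true]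

lemma sum_erase_eq {n : ℕ} {G : Type*} [AddCommGroup G] {i₀ i₁ : Fin n} (h01 : i₀ ≠ i₁)
    (φ ψ : Fin n → G) (hφ : ∀ i, i ≠ i₀ → φ i = ψ i) :
    ∑ i ∈ Finset.univ.erase i₁, φ i = ∑ i, ψ i - ψ i₁ - ψ i₀ + φ i₀ := by
  have hi0 : i₀ ∈ Finset.univ.erase i₁ := by simp [h01]
  rw [← Finset.add_sum_erase _ _ hi0, ← Finset.add_sum_erase _ ψ (Finset.mem_univ i₁),
    ← Finset.add_sum_erase _ ψ hi0,
    Finset.sum_congr rfl fun i hi => hφ i (Finset.ne_of_mem_erase hi)]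
  abel

/-- Cauchy–Schwarz for the `n - 1` vectors `a i₀ + a i₁` and `a i`, `i ≠ i₀, i₁`. -/
lemma norm_sum_sq_le {n : ℕ} (a : Fin n → V) {i₀ i₁ : Fin n} (h01 : i₀ ≠ i₁) :
    ‖∑ i, a i‖ ^ 2 ≤ ((n : ℝ) - 1) * (∑ i, ‖a i‖ ^ 2 + 2 * inner ℝ (a i₀) (a i₁)) := by
  let b : Fin n → V := fun i => if i = i₀ then a i₀ + a i₁ else a i
  have h1 : ∑ i ∈ Finset.univ.erase i₁, b i = ∑ i, a i := by
    rw [sum_erase_eq h01 b a fun i hi => if_neg hi]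
    simp only [b, if_pos]
    abel
  have h2 : ∑ i ∈ Finset.univ.erase i₁, ‖b i‖ ^ 2
      = ∑ i, ‖a i‖ ^ 2 + 2 * inner ℝ (a i₀) (a i₁) := by
    rw [sum_erase_eq h01 (fun i => ‖b i‖ ^ 2) (fun i => ‖a i‖ ^ 2) fun i hi => by simp [b, hi]]
    simp only [b, if_pos, norm_add_sq_real]
    ring
  have hcard : ((Finset.univ.erase i₁).card : ℝ) = (n : ℝ) - 1 := by
    rw [Finset.card_erase_of_mem (Finset.mem_univ _), Finset.card_univ, Fintype.card_fin,
      Nat.cast_sub (by have := i₁.2; omega), Nat.cast_one]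
  rw [← h1, ← h2, ← hcard]
  calc ‖∑ i ∈ Finset.univ.erase i₁, b i‖ ^ 2 ≤ (∑ i ∈ Finset.univ.erase i₁, ‖b i‖) ^ 2 := by
        gcongr; exact norm_sum_le _ _
    _ ≤ _ := sq_sum_le_card_mul_sum_sq

/-- A sum of nonnegative matrix entries is at least the diagonal plus one symmetric pair. -/
lemma sum_diag_add_le_sum {n : ℕ} (a : Fin n → Fin n → ℝ) (ha : ∀ i j, 0 ≤ a i j)
    {i₀ i₁ : Fin n} (h01 : i₀ ≠ i₁) :
    ∑ i, a i i + (a i₀ i₁ + a i₁ i₀) ≤ ∑ i, ∑ j, a i j := by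
  -- each entry is charged at most once, since the positions `(i, i)`, `(i₀, i₁)`, `(i₁, i₀)` differ
  have h : ∀ i j, (if j = i then a i j else 0)
      + ((if i = i₀ then if j = i₁ then a i j else 0 else 0)
      + (if i = i₁ then if j = i₀ then a i j else 0 else 0)) ≤ a i j := by
    intro i j
    have := ha i j
    split_ifs <;> simp_all
  refine Eq.trans_le ?_ (Finset.sum_le_sum fun i _ => Finset.sum_le_sum fun j _ => h i j)
  have h' (i : Fin n) (p : Prop) [Decidable p] (k : Fin n) :
      ∑ j, (if p then if j = k then a i j else 0 else 0) = if p then a i k else 0 := by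
    split_ifs <;> simp
  simp only [Finset.sum_add_distrib, h', Finset.sum_ite_eq', Finset.mem_univ, if_true]

/-- Chen's lemma for a vector-valued symmetric matrix. -/
lemma chen_matrix_le {n : ℕ} (hn : 2 ≤ n) (a : Fin n → Fin n → V) (ha : ∀ i j, a i j = a j i)
    {i₀ i₁ : Fin n} (h01 : i₀ ≠ i₁) :
    1 / 2 * (‖∑ i, a i i‖ ^ 2 - ∑ i, ∑ j, ‖a i j‖ ^ 2)
        - (inner ℝ (a i₀ i₀) (a i₁ i₁) - ‖a i₀ i₁‖ ^ 2)
      ≤ ((n : ℝ) - 2) / (2 * ((n : ℝ) - 1)) * ‖∑ i, a i i‖ ^ 2 := by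
  have hn' : (2 : ℝ) ≤ n := by exact_mod_cast hn
  have h1 := norm_sum_sq_le (fun i => a i i) h01
  have h2 := sum_diag_add_le_sum (fun i j => ‖a i j‖ ^ 2) (fun i j => by positivity) h01
  simp only [ha i₁ i₀] at h2
  set S := ‖∑ i, a i i‖ ^ 2
  have h3 : S / ((n : ℝ) - 1) ≤ ∑ i, ‖a i i‖ ^ 2 + 2 * inner ℝ (a i₀ i₀) (a i₁ i₁) := by
    rw [div_le_iff₀ (by linarith), mul_comm]
    exact h1
  have h4 : ((n : ℝ) - 2) / (2 * ((n : ℝ) - 1)) * S = 1 / 2 * (S - S / ((n : ℝ) - 1)) := by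
    have : (n : ℝ) - 1 ≠ 0 := by linarith
    field_simp
    ring
  rw [h4]
  linarith

/-- Gram–Schmidt for two vectors. -/
lemma exists_orthonormal_pair {u v : D} (huv : LinearIndependent ℝ ![u, v]) :
    ∃ (e f : D) (r s t : ℝ), inner ℝ e e = (1 : ℝ) ∧ inner ℝ f f = (1 : ℝ) ∧
      inner ℝ e f = (0 : ℝ) ∧ r ≠ 0 ∧ t ≠ 0 ∧ u = r • e ∧ v = s • e + t • f := by
  have hu : u ≠ 0 := huv.ne_zero 0
  have hu' : ‖u‖ ≠ 0 := norm_ne_zero_iff.2 hu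
  let e := ‖u‖⁻¹ • u
  have hue : u = ‖u‖ • e := by simp [e, smul_smul, hu']
  have hee : inner ℝ e e = (1 : ℝ) := by
    rw [real_inner_self_eq_norm_sq, norm_smul, norm_inv, norm_norm, inv_mul_cancel₀ hu', one_pow]
  let w := v - (inner ℝ e v : ℝ) • e
  have hw : w ≠ 0 := by
    intro h
    have h1 : (-(inner ℝ e v : ℝ) * ‖u‖⁻¹) • u + (1 : ℝ) • v = 0 := by
      rw [mul_smul, one_smul, neg_smul, neg_add_eq_sub]; exact h
    exact one_ne_zero (LinearIndependent.pair_iff.1 huv _ _ h1).2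
  have hw' : ‖w‖ ≠ 0 := norm_ne_zero_iff.2 hw
  refine ⟨e, ‖w‖⁻¹ • w, ‖u‖, inner ℝ e v, ‖w‖, hee, ?_, ?_, hu', hw', hue, ?_⟩
  · rw [real_inner_self_eq_norm_sq, norm_smul, norm_inv, norm_norm, inv_mul_cancel₀ hw', one_pow]
  · simp only [w, inner_smul_right, inner_sub_right, hee]; ring
  · rw [smul_inv_smul₀ hw']; simp [w]

/-- Chen's inequality for an algebraic curvature tensor `Rm` which arises from a symmetric bilinear
form `B` by the Gauss equation in a space of constant curvature `κ`. -/
theorem chen_algebraic {n : ℕ} (hn : 2 ≤ n) (hD : Module.finrank ℝ D = n) {κ : ℝ}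
    {Rm : D → D → D → D → ℝ} (B : D →ₗ[ℝ] D →ₗ[ℝ] V) (hB : ∀ u v, B u v = B v u)
    (hRm : ∀ u v, Rm u v v u = κ * (inner ℝ u u * inner ℝ v v - inner ℝ u v ^ 2)
      + (inner ℝ (B u u) (B v v) - ‖B u v‖ ^ 2))
    {ι : Type*} [Fintype ι] (e : OrthonormalBasis ι ℝ D) {u v : D}
    (huv : LinearIndependent ℝ ![u, v]) :
    1 / 2 * ∑ i, ∑ j, Rm (e i) (e j) (e j) (e i)
        - Rm u v v u / (inner ℝ u u * inner ℝ v v - inner ℝ u v ^ 2)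
      ≤ κ * ((n : ℝ) ^ 2 - n - 2) / 2
        + ((n : ℝ) - 2) / (2 * ((n : ℝ) - 1)) * ‖∑ i, B (e i) (e i)‖ ^ 2 := by
  classical
  obtain ⟨x, y, r, s, t, hxx, hyy, hxy, hr, ht, rfl, rfl⟩ := exists_orthonormal_pair huv
  let i₀ : Fin n := ⟨0, by omega⟩
  let i₁ : Fin n := ⟨1, by omega⟩
  have h01 : i₀ ≠ i₁ := by simp [i₀, i₁]
  have : FiniteDimensional ℝ D := FiniteDimensional.of_finrank_pos (by omega)
  obtain ⟨f, hf0, hf1⟩ : ∃ f : OrthonormalBasis (Fin n) ℝ D, f i₀ = x ∧ f i₁ = y := by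
    let g : Fin n → D := fun i => if i = i₀ then x else y
    have hx1 : ‖x‖ = 1 := by rw [norm_eq_sqrt_real_inner, hxx, Real.sqrt_one]
    have hy1 : ‖y‖ = 1 := by rw [norm_eq_sqrt_real_inner, hyy, Real.sqrt_one]
    have hg : Orthonormal ℝ (({i₀, i₁} : Set (Fin n)).domRestrict g) := by
      rw [orthonormal_iff_ite]
      rintro ⟨i, rfl | rfl⟩ ⟨j, rfl | rfl⟩ <;>
        simp [Set.domRestrict_apply, g, h01.symm, hx1, hy1, hxy, real_inner_comm x y]
      · exact fun h => h01 (congrArg Subtype.val h)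
      · exact fun h => h01.symm (congrArg Subtype.val h)
    obtain ⟨f, hf⟩ := hg.exists_orthonormalBasis_extension_of_card_eq (by simp [hD])
    exact ⟨f, by simpa [g] using hf i₀ (by simp), by simpa [g, h01.symm] using hf i₁ (by simp)⟩
  -- the sectional curvature only depends on the plane
  have hK : Rm (r • x) (s • x + t • y) (s • x + t • y) (r • x)
      / (inner ℝ (r • x) (r • x) * inner ℝ (s • x + t • y) (s • x + t • y)
        - inner ℝ (r • x) (s • x + t • y) ^ 2)
      = κ + (inner ℝ (B x x) (B y y) - ‖B x y‖ ^ 2) := by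
    have hden : (inner ℝ (r • x) (r • x) * inner ℝ (s • x + t • y) (s • x + t • y)
        - inner ℝ (r • x) (s • x + t • y) ^ 2 : ℝ) = (r * t) ^ 2 := by
      simp only [inner_add_left, inner_add_right, inner_smul_left, inner_smul_right, hxx, hyy, hxy,
        real_inner_comm x y, RCLike.conj_to_real]
      ring
    rw [hRm, hden, div_eq_iff (pow_ne_zero 2 (mul_ne_zero hr ht)),
      ← real_inner_self_eq_norm_sq, ← real_inner_self_eq_norm_sq]
    simp only [map_add, map_smul, LinearMap.add_apply, LinearMap.smul_apply, inner_add_left,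
      inner_add_right, inner_smul_left, inner_smul_right, RCLike.conj_to_real, hB y x,
      real_inner_comm (B x x) (B x y)]
    ring
  have hsum : ∑ i, ∑ j, ‖B (e i) (e j)‖ ^ 2 = ∑ i, ∑ j, ‖B (f i) (f j)‖ ^ 2 := by
    have h1 (w : D) : ∑ j, ‖B w (e j)‖ ^ 2 = ∑ j, ‖B w (f j)‖ ^ 2 := by
      simpa [real_inner_self_eq_norm_sq] using
        sum_bilin_orthonormalBasis e f ((innerₗ V).compl₁₂ (B w) (B w))
    have h2 (w : D) : ∑ j, ‖B (e j) w‖ ^ 2 = ∑ j, ‖B (f j) w‖ ^ 2 := by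
      simpa only [hB _ w] using h1 w
    simp only [h1]
    rw [Finset.sum_comm]
    simp only [h2]
    rw [Finset.sum_comm]
  have hcard : (Fintype.card ι : ℝ) = n := by
    rw [← Module.finrank_eq_card_basis e.toBasis, hD]
  have hnorm : ‖∑ i, B (e i) (e i)‖ ^ 2
      = ∑ i, ∑ j, (inner ℝ (B (e i) (e i)) (B (e j) (e j)) : ℝ) := by
    rw [← real_inner_self_eq_norm_sq, sum_inner]
    simp only [inner_sum]
  have hτ : ∑ i, ∑ j, Rm (e i) (e j) (e j) (e i) = κ * ((n : ℝ) ^ 2 - n)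
      + (‖∑ i, B (e i) (e i)‖ ^ 2 - ∑ i, ∑ j, ‖B (e i) (e j)‖ ^ 2) := by
    rw [hnorm]
    simp only [hRm, Finset.sum_add_distrib, Finset.sum_sub_distrib, ← Finset.mul_sum,
      e.inner_eq_ite, if_true, ite_pow, one_pow, zero_pow two_ne_zero, Finset.sum_const,
      Finset.sum_ite_eq, Finset.mem_univ, Finset.card_univ, nsmul_eq_mul, hcard, mul_one]
    ring
  rw [hK, hτ, hsum, sum_bilin_orthonormalBasis e f B]
  have hchen := chen_matrix_le hn (fun i j => B (f i) (f j)) (fun i j => hB _ _) h01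
  simp only [hf0, hf1] at hchen
  linarith

end LinearAlgebra

/-! ### The metallic splitting and the Gauss equation -/

section Metallic

set_option linter.unusedSectionVars false

variable {E : Type*} [NormedAddCommGroup E] [NormedSpace ℝ E]
  {H : Type*} [TopologicalSpace H] {I : ModelWithCorners ℝ E H}
  {M : Type*} [TopologicalSpace M] [ChartedSpace H M] [IsManifold I ∞ M]

lemma smoothEndo_id :
    SmoothEndo (fun x : M => ContinuousLinearMap.id ℝ (TangentSpace I x)) := fun x => by
  rw [contMDiffAt_hom_bundle]
  refine ⟨contMDiffAt_id,
    (contMDiffAt_const (c := ContinuousLinearMap.id ℝ E)).congr_of_eventuallyEq ?_⟩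
  filter_upwards [(trivializationAt E (TangentSpace I) x).open_baseSet.mem_nhds
    (FiberBundle.mem_baseSet_trivializationAt' x)] with y hy
  rw [ContinuousLinearMap.inCoordinates_eq hy hy]
  ext v
  simp

lemma SmoothEndo.linear_comb {J : Π x : M, TangentSpace I x →L[ℝ] TangentSpace I x}
    (hJ : SmoothEndo J) (a b : ℝ) :
    SmoothEndo (fun x => a • J x + b • ContinuousLinearMap.id ℝ (TangentSpace I x)) :=
  ContMDiff.add_section (ContMDiff.const_smul_section (a := a) hJ)
    (ContMDiff.const_smul_section (a := b) smoothEndo_id)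

variable [FiniteDimensional ℝ E]
  [RiemannianBundle (fun x : M => TangentSpace I x)]
  [IsContMDiffRiemannianBundle I ∞ E (fun x : M => TangentSpace I x)]
  {nabla : CovariantDerivative I E (fun x : M => TangentSpace I x)}
  {p q : ℝ} {J : Π x : M, TangentSpace I x →L[ℝ] TangentSpace I x}

lemma projP_apply (x : M) (v : TangentSpace I x) : projP p q J x v
    = -(1 / √(p ^ 2 + 4 * q)) • J x v + (sigmaPlus p q / √(p ^ 2 + 4 * q)) • v := rfl

lemma projP'_apply (hpq : 0 < p ^ 2 + 4 * q) (x : M) (v : TangentSpace I x) :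
    projP' p q J x v = v - projP p q J x v := by
  have hd : √(p ^ 2 + 4 * q) ≠ 0 := (Real.sqrt_pos.2 hpq).ne'
  have h : sigmaPlus p q / √(p ^ 2 + 4 * q) - sigmaMinus p q / √(p ^ 2 + 4 * q) = 1 := by
    rw [sigmaPlus, sigmaMinus]; field_simp; ring
  rw [projP_apply]
  change (1 / √(p ^ 2 + 4 * q)) • J x v - (sigmaMinus p q / √(p ^ 2 + 4 * q)) • v = _
  match_scalars
  · ring
  · linarith

lemma mem_distD (hpq : 0 < p ^ 2 + 4 * q) {x : M} {v : TangentSpace I x} :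
    v ∈ distD p q J x ↔ projP p q J x v = v := by
  change projP' p q J x v = 0 ↔ _
  rw [projP'_apply hpq, sub_eq_zero, eq_comm]

lemma isProjectionField_projP (hpq : 0 < p ^ 2 + 4 * q) (hJ : IsMetallicRiemannian p q J) :
    IsProjectionField (projP p q J) where
  smooth := hJ.smooth.linear_comb _ _
  idem x v := by
    have hd : √(p ^ 2 + 4 * q) ≠ 0 := (Real.sqrt_pos.2 hpq).ne'
    have hd2 : √(p ^ 2 + 4 * q) ^ 2 = p ^ 2 + 4 * q := Real.sq_sqrt hpq.le
    simp only [projP_apply, map_add, map_smul, hJ.sq, sigmaPlus]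
    set d := √(p ^ 2 + 4 * q)
    match_scalars
    · field_simp
      ring
    · field_simp
      linear_combination -hd2
  symm x v w := by
    simp only [projP_apply, inner_add_left, inner_add_right, inner_smul_left, inner_smul_right,
      hJ.symm, RCLike.conj_to_real]

/-- The spectral decomposition of `a J + b I`. -/
lemma metallic_comb_eq (hpq : 0 < p ^ 2 + 4 * q) (a b : ℝ) (x : M) (v : TangentSpace I x) :
    a • J x v + b • v = (a * sigmaMinus p q + b) • projP p q J x v
      + (a * sigmaPlus p q + b) • (v - projP p q J x v) := by
  have hd : √(p ^ 2 + 4 * q) ≠ 0 := (Real.sqrt_pos.2 hpq).ne'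
  simp only [projP_apply, sigmaPlus, sigmaMinus]
  match_scalars
  · field_simp; ring
  · field_simp; ring

lemma metallic_eigenvalue_mul (hpq : 0 < p ^ 2 + 4 * q) {a b : ℝ}
    (hab : q * a ^ 2 - p * a * b - b ^ 2 = 1) :
    (a * sigmaMinus p q + b) * (a * sigmaPlus p q + b) = -1 := by
  have hd2 : √(p ^ 2 + 4 * q) ^ 2 = p ^ 2 + 4 * q := Real.sq_sqrt hpq.le
  rw [sigmaPlus, sigmaMinus]
  linear_combination -hab - a ^ 2 / 4 * hd2

variable [T2Space M]

/-- The covariant derivative of a not necessarily smooth field only depends on its germ, as soon as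
this is the germ of a smooth field. -/
lemma nabla_congr (nabla : CovariantDerivative I E (fun x : M => TangentSpace I x))
    {Z : Π y : M, TangentSpace I y} {Z' : VField I M} {x : M}
    (h : ∀ᶠ y in 𝓝 x, Z' y = Z y) : nabla Z x = nabla Z' x := by
  refine nabla.isCovariantDerivativeOnUniv.congr_of_eventuallyEq ?_ (Z'.mdiffAt x) univ_mem
    (h.mono fun y hy => hy.symm)
  refine (Z'.mdiffAt x).congr_of_eventuallyEq (h.mono fun y hy => ?_)
  simp [hy]

/-- Near `x`, the local section `extendD p q J v` is the restriction of a global smooth section of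
the distribution. -/
lemma exists_tangent_eventuallyEq_extendD (hpq : 0 < p ^ 2 + 4 * q)
    (hJ : IsMetallicRiemannian p q J) {x : M} {v : TangentSpace I x} (hv : v ∈ distD p q J x) :
    ∃ X : VField I M, IsTangent (projP p q J) X ∧ X x = v
      ∧ ∀ᶠ y in 𝓝 x, X y = extendD p q J v y := by
  have hP := isProjectionField_projP hpq hJ
  obtain ⟨X, hX⟩ := exists_field_eventuallyEq_extend v
  refine ⟨applyEndo hP.smooth X, fun y => hP.idem y _, ?_, hX.mono fun y hy => ?_⟩
  · rw [applyEndo_apply, hX.self_of_nhds, FiberBundle.extend_apply_self, (mem_distD hpq).1 hv]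
  · rw [applyEndo_apply, hy]; rfl

/-- The normal part of `∇_u X` depends only on the value of the section `X` at the base point. -/
lemma cov_sub_proj_congr {P : Π x : M, TangentSpace I x →L[ℝ] TangentSpace I x}
    (hP : IsProjectionField P) (hnabla : IsLeviCivita nabla) {X Y : VField I M}
    (hX : IsTangent P X) (hY : IsTangent P Y) {x : M} (h : X x = Y x) (u : TangentSpace I x) :
    nabla X x u - P x (nabla X x u) = nabla Y x u - P x (nabla Y x u) := by
  rw [← sub_eq_zero, ← inner_self_eq_zero (𝕜 := ℝ)]
  set z := nabla X x u - P x (nabla X x u) - (nabla Y x u - P x (nabla Y x u)) with hz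
  have hz0 : P x z = 0 := by simp [hz, hP.idem]
  obtain ⟨U, hU, hUz⟩ := hP.exists_normal hz0
  nth_rw 2 [← hUz]
  rw [hz, inner_sub_left, inner_sub_left, inner_sub_left, hP.inner_eq_zero (hP.idem _ _) (hU x),
    hP.inner_eq_zero (hP.idem _ _) (hU x)]
  have h1 := hP.inner_cov_normal hnabla hX hU x u
  have h2 := hP.inner_cov_normal hnabla hY hU x u
  rw [h] at h1
  linarith

/-- The second fundamental form may be computed with any section through the second vector. -/
lemma secondFF_eq (hpq : 0 < p ^ 2 + 4 * q) (hJ : IsMetallicRiemannian p q J)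
    (hnabla : IsLeviCivita nabla) {X : VField I M} (hX : IsTangent (projP p q J) X) {x : M}
    (u : TangentSpace I x) : secondFF p q J nabla x u (X x)
      = nabla X x u - projP p q J x (nabla X x u) := by
  obtain ⟨Y, hY, hYx, hYe⟩ := exists_tangent_eventuallyEq_extendD hpq hJ
    ((mem_distD hpq).2 (hX x))
  rw [secondFF, projP'_apply hpq, nabla_congr nabla hYe]
  exact cov_sub_proj_congr (isProjectionField_projP hpq hJ) hnabla hY hX hYx u

/-- The second fundamental form as a bilinear map on `𝒟 x`. -/
def secondFFBilin (hpq : 0 < p ^ 2 + 4 * q) (hJ : IsMetallicRiemannian p q J)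
    (hnabla : IsLeviCivita nabla) (x : M) :
    distD p q J x →ₗ[ℝ] distD p q J x →ₗ[ℝ] TangentSpace I x :=
  LinearMap.mk₂ ℝ (fun u v => secondFF p q J nabla x u v)
    (fun u u' v => by simp [secondFF])
    (fun r u v => by simp [secondFF])
    (fun u v w => by
      obtain ⟨X, hX, hXx⟩ := (isProjectionField_projP hpq hJ).exists_tangent
        ((mem_distD hpq).1 v.2)
      obtain ⟨Y, hY, hYx⟩ := (isProjectionField_projP hpq hJ).exists_tangent
        ((mem_distD hpq).1 w.2)
      have hXY : IsTangent (projP p q J) (X + Y) := fun y => by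
        rw [ContMDiffSection.coe_add, Pi.add_apply, map_add, hX, hY]
      have h := secondFF_eq hpq hJ hnabla hXY (u : TangentSpace I x)
      obtain ⟨U, hU⟩ := exists_field (u : TangentSpace I x)
      have h2 := congrArg (fun V : VField I M => V x) (cov_add_right hnabla U X Y)
      simp only [cov_apply, ContMDiffSection.coe_add, Pi.add_apply, hU] at h2
      rw [Submodule.coe_add, ← hXx, ← hYx, secondFF_eq hpq hJ hnabla hX,
        secondFF_eq hpq hJ hnabla hY]
      refine h.trans ?_
      rw [ContMDiffSection.coe_add, h2, map_add]
      abel)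
    (fun r u v => by
      obtain ⟨X, hX, hXx⟩ := (isProjectionField_projP hpq hJ).exists_tangent
        ((mem_distD hpq).1 v.2)
      have hrX : IsTangent (projP p q J) (r • X) := fun y => by
        rw [ContMDiffSection.coe_smul, Pi.smul_apply, map_smul, hX]
      have h := secondFF_eq hpq hJ hnabla hrX (u : TangentSpace I x)
      obtain ⟨U, hU⟩ := exists_field (u : TangentSpace I x)
      have h2 := congrArg (fun V : VField I M => V x) (cov_smul_right hnabla r U X)
      simp only [cov_apply, ContMDiffSection.coe_smul, Pi.smul_apply, hU] at h2
      rw [Submodule.coe_smul, ← hXx, secondFF_eq hpq hJ hnabla hX]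
      refine h.trans ?_
      rw [ContMDiffSection.coe_smul, h2, map_smul, smul_sub])

lemma secondFFBilin_apply (hpq : 0 < p ^ 2 + 4 * q) (hJ : IsMetallicRiemannian p q J)
    (hnabla : IsLeviCivita nabla) (x : M) (u v : distD p q J x) :
    secondFFBilin hpq hJ hnabla x u v = secondFF p q J nabla x u v := rfl

lemma secondFF_symm (hpq : 0 < p ^ 2 + 4 * q) (hJ : IsMetallicRiemannian p q J)
    (hnabla : IsLeviCivita nabla) (hinv : IsInvolutive (projP p q J)) {x : M}
    {u v : TangentSpace I x} (hu : u ∈ distD p q J x) (hv : v ∈ distD p q J x) :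
    secondFF p q J nabla x u v = secondFF p q J nabla x v u := by
  obtain ⟨X, hX, rfl⟩ := (isProjectionField_projP hpq hJ).exists_tangent ((mem_distD hpq).1 hu)
  obtain ⟨Y, hY, rfl⟩ := (isProjectionField_projP hpq hJ).exists_tangent ((mem_distD hpq).1 hv)
  have h := hinv X Y hX hY x
  rw [bracket_eq hnabla] at h
  simp only [ContMDiffSection.coe_sub, Pi.sub_apply, cov_apply, map_sub] at h
  rw [secondFF_eq hpq hJ hnabla hX, secondFF_eq hpq hJ hnabla hY, sub_eq_sub_iff_sub_eq_sub, h]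

/-- The Gauss equation for the curvature of the distribution, whose defining local sections are
germs of the global sections `X`, `Y`, `Z`. -/
lemma riemannD_eq (hpq : 0 < p ^ 2 + 4 * q) (hJ : IsMetallicRiemannian p q J)
    (hnabla : IsLeviCivita nabla) {x : M} {X Y Z W : VField I M}
    (hX : IsTangent (projP p q J) X) (hY : IsTangent (projP p q J) Y)
    (hZ : IsTangent (projP p q J) Z) (hW : IsTangent (projP p q J) W)
    (hXe : ∀ᶠ y in 𝓝 x, X y = extendD p q J (X x) y)
    (hYe : ∀ᶠ y in 𝓝 x, Y y = extendD p q J (Y x) y)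
    (hZe : ∀ᶠ y in 𝓝 x, Z y = extendD p q J (Z x) y) :
    riemannD p q J nabla x (X x) (Y x) (Z x) (W x) = inner ℝ (curv hnabla X Y Z x) (W x)
      + (inner ℝ (secondFF p q J nabla x (Y x) (Z x)) (secondFF p q J nabla x (X x) (W x))
        - inner ℝ (secondFF p q J nabla x (X x) (Z x)) (secondFF p q J nabla x (Y x) (W x))) := by
  have hP := isProjectionField_projP hpq hJ
  have hind {A : VField I M} (hAe : ∀ᶠ y in 𝓝 x, A y = extendD p q J (A x) y) :
      ∀ᶠ y in 𝓝 x, applyEndo hP.smooth (cov hnabla A Z) y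
        = inducedConn p q J nabla (extendD p q J (Z x)) y (extendD p q J (A x) y) := by
    filter_upwards [hAe, hZe.eventually_nhds] with y hy hZy
    rw [inducedConn, nabla_congr nabla hZy, ← hy]
    rfl
  -- the tangential derivative of the tangential part of `∇_A Z`
  have hder {A B : VField I M} (hA : IsTangent (projP p q J) A) :
      (inner ℝ (projP p q J x (nabla (applyEndo hP.smooth (cov hnabla A Z)) x (B x))) (W x) : ℝ)
        = inner ℝ (nabla (cov hnabla A Z) x (B x)) (W x)
          + inner ℝ (secondFF p q J nabla x (A x) (Z x)) (secondFF p q J nabla x (B x) (W x)) := by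
    have hN : IsNormal (projP p q J) (cov hnabla A Z - applyEndo hP.smooth (cov hnabla A Z)) :=
      fun y => by
        rw [ContMDiffSection.coe_sub, Pi.sub_apply, map_sub, applyEndo_apply, hP.idem, sub_self]
    have h1 := hP.inner_cov_normal hnabla hW hN x (B x)
    have h2 := congrArg (fun V : VField I M => V x)
      (cov_sub_right hnabla B (cov hnabla A Z) (applyEndo hP.smooth (cov hnabla A Z)))
    simp only [cov_apply, ContMDiffSection.coe_sub, Pi.sub_apply] at h2
    rw [ContMDiffSection.coe_sub, h2, inner_sub_left] at h1
    rw [hP.symm, hW x, secondFF_eq hpq hJ hnabla hZ, secondFF_eq hpq hJ hnabla hW,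
      inner_sub_right, hP.inner_eq_zero' (w := projP p q J x (nabla W x (B x)))
        (by rw [map_sub, hP.idem, sub_self]) (hP.idem x _), sub_zero,
      real_inner_comm (nabla W x (B x))]
    simp only [Pi.sub_apply, applyEndo_apply, cov_apply] at h1
    linarith
  have hcov {A : VField I M} (hAe : ∀ᶠ y in 𝓝 x, A y = extendD p q J (A x) y) :
      inducedConn p q J nabla
        (fun y => inducedConn p q J nabla (extendD p q J (Z x)) y (extendD p q J (A x) y)) x
        = projP p q J x ∘L nabla (applyEndo hP.smooth (cov hnabla A Z)) x := by
    rw [inducedConn, nabla_congr nabla (hind hAe)]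
  have hbr : mlieBracket I (extendD p q J (X x)) (extendD p q J (Y x)) x = bracket X Y x :=
    (Filter.EventuallyEq.mlieBracket_vectorField_eq hXe hYe).symm
  rw [riemannD, curvature, hcov hXe, hcov hYe, hbr, ← hXe.self_of_nhds, ← hYe.self_of_nhds,
    inducedConn, nabla_congr nabla hZe]
  simp only [ContinuousLinearMap.comp_apply]
  rw [inner_sub_left, inner_sub_left, hder hX, hder hY, hP.symm, hW x, curv]
  simp only [ContMDiffSection.coe_sub, Pi.sub_apply, cov_apply, inner_sub_left]
  ring

end Metallic

/-! ### Consequences of the rank and curvature hypotheses -/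

section Sign

set_option linter.unusedSectionVars false

variable {E : Type*} [NormedAddCommGroup E] [NormedSpace ℝ E]
  {H : Type*} [TopologicalSpace H] {I : ModelWithCorners ℝ E H}
  {M : Type*} [TopologicalSpace M] [ChartedSpace H M] [IsManifold I ∞ M]
  [FiniteDimensional ℝ E]
  [RiemannianBundle (fun x : M => TangentSpace I x)]
  [IsContMDiffRiemannianBundle I ∞ E (fun x : M => TangentSpace I x)]
  {nabla : CovariantDerivative I E (fun x : M => TangentSpace I x)}
  {p q : ℝ} {J : Π x : M, TangentSpace I x →L[ℝ] TangentSpace I x}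

lemma exists_mem_ne_zero_inner_eq_zero {x : M} {D : Submodule ℝ (TangentSpace I x)}
    (hD : 2 ≤ Module.finrank ℝ D) (w : TangentSpace I x) :
    ∃ v ∈ D, v ≠ 0 ∧ (inner ℝ v w : ℝ) = 0 := by
  have : FiniteDimensional ℝ (TangentSpace I x) := inferInstanceAs (FiniteDimensional ℝ E)
  have h : LinearMap.ker ((innerₗ (TangentSpace I x) w).domRestrict D) ≠ ⊥ :=
    LinearMap.ker_ne_bot_of_finrank_lt (by rw [Module.finrank_self]; omega)
  obtain ⟨v, hv, hv0⟩ := (Submodule.ne_bot_iff _).1 h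
  refine ⟨v, v.2, by simpa using hv0, ?_⟩
  rw [real_inner_comm]
  exact hv

lemma exists_unit_mem_inner_eq_zero {x : M} {D : Submodule ℝ (TangentSpace I x)}
    (hD : 2 ≤ Module.finrank ℝ D) (w : TangentSpace I x) :
    ∃ v ∈ D, (inner ℝ v v : ℝ) = 1 ∧ (inner ℝ v w : ℝ) = 0 := by
  obtain ⟨v, hv, hv0, hvw⟩ := exists_mem_ne_zero_inner_eq_zero hD w
  refine ⟨‖v‖⁻¹ • v, D.smul_mem _ hv, ?_, ?_⟩
  · rw [real_inner_self_eq_norm_sq, norm_smul, norm_inv, norm_norm,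
      inv_mul_cancel₀ (norm_ne_zero_iff.2 hv0), one_pow]
  · rw [inner_smul_left, hvw, mul_zero]

lemma isInvolutive_projP (hpq : 0 < p ^ 2 + 4 * q)
    (hint : IsIntegrable (distD p q J)) : IsInvolutive (projP p q J) :=
  fun X Y hX hY x => (mem_distD hpq).1 <| hint X Y X.contMDiff Y.contMDiff
    (fun y => (mem_distD hpq).2 (hX y)) (fun y => (mem_distD hpq).2 (hY y)) x

/-- The hypothesis on the `(0, 4)`-curvature, tested on all fields `W`, as an identity of
vectors. -/
lemma curv_eq [T2Space M] {F : Π x : M, TangentSpace I x →L[ℝ] TangentSpace I x} {c : ℝ}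
    (hnabla : IsLeviCivita nabla)
    (hF : ∀ (x : M) (v w : TangentSpace I x), (inner ℝ (F x v) w : ℝ) = inner ℝ v (F x w))
    (hR : ∀ X Y Z W : Π x : M, TangentSpace I x, SmoothField X → SmoothField Y →
      SmoothField Z → SmoothField W → ∀ x : M, riemannM nabla X Y Z W x
        = c * (inner ℝ (X x) (F x (W x)) * inner ℝ (Y x) (F x (Z x))
          - inner ℝ (X x) (F x (Z x)) * inner ℝ (Y x) (F x (W x))))
    (X Y Z : VField I M) (x : M) : curv hnabla X Y Z x
      = c • ((inner ℝ (F x (Y x)) (Z x) : ℝ) • F x (X x)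
          - (inner ℝ (F x (X x)) (Z x) : ℝ) • F x (Y x)) := by
  refine ext_inner_right ℝ fun w => ?_
  obtain ⟨W, rfl⟩ := exists_field w
  refine (hR X Y Z W X.contMDiff Y.contMDiff Z.contMDiff W.contMDiff x).trans ?_
  simp only [inner_smul_left, inner_sub_left, hF, RCLike.conj_to_real]
  ring

end Sign

end MetallicChen

end

/-! ### The Chen-type inequality -/

theorem mainTheorem3 (m n : ℕ) (hm : 2 < m) (hn : 2 ≤ n) (hnm : n < m)
    {M : Type*} [TopologicalSpace M] [T2Space M] [SecondCountableTopology M]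
    [ChartedSpace (EuclideanSpace ℝ (Fin m)) M] [IsManifold (𝓡 m) ∞ M]
    [RiemannianBundle (fun x : M => TangentSpace (𝓡 m) x)]
    [IsContMDiffRiemannianBundle (𝓡 m) ∞ (EuclideanSpace ℝ (Fin m))
      (fun x : M => TangentSpace (𝓡 m) x)]
    (nabla : CovariantDerivative (𝓡 m) (EuclideanSpace ℝ (Fin m))
      (fun x : M => TangentSpace (𝓡 m) x))
    (hnabla : MetallicChen.IsLeviCivita nabla)
    (p q a b c : ℝ) (hpq : 0 < p ^ 2 + 4 * q)
    (J : Π x : M, TangentSpace (𝓡 m) x →L[ℝ] TangentSpace (𝓡 m) x)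
    (hJ : MetallicChen.IsMetallicRiemannian p q J)
    (hab : q * a ^ 2 - p * a * b - b ^ 2 = 1)
    (F : Π x : M, TangentSpace (𝓡 m) x →L[ℝ] TangentSpace (𝓡 m) x)
    (hF : ∀ (x : M) (v : TangentSpace (𝓡 m) x), F x v = a • J x v + b • v)
    (hR : ∀ X Y Z W : Π x : M, TangentSpace (𝓡 m) x,
      MetallicChen.SmoothField X → MetallicChen.SmoothField Y →
      MetallicChen.SmoothField Z → MetallicChen.SmoothField W → ∀ x : M,
      MetallicChen.riemannM nabla X Y Z W x
        = c * (inner ℝ (X x) (F x (W x)) * inner ℝ (Y x) (F x (Z x))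
          - inner ℝ (X x) (F x (Z x)) * inner ℝ (Y x) (F x (W x))))
    (hrank : ∀ x : M, Module.finrank ℝ (MetallicChen.distD p q J x) = n)
    (hint : MetallicChen.IsIntegrable (MetallicChen.distD p q J))
    (x : M) :
    MetallicChen.chenInvariant p q J nabla x
      ≤ c * (a * MetallicChen.sigmaMinus p q + b) ^ 2 * ((n : ℝ) ^ 2 - n + 2) / 2
        + (n : ℝ) ^ 2 * ((n : ℝ) - 2) / (2 * ((n : ℝ) - 1))
          * ‖MetallicChen.meanCurvature p q J nabla x‖ ^ 2 := by
  open MetallicChen in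
  have hP := isProjectionField_projP hpq hJ
  have hinv := isInvolutive_projP hpq hint
  have hFs : SmoothEndo F := by
    have : F = fun x => a • J x + b • ContinuousLinearMap.id ℝ (TangentSpace (𝓡 m) x) := by
      funext x
      ext1 v
      exact hF x v
    rw [this]
    exact hJ.smooth.linear_comb a b
  have hFsymm (x : M) (v w : TangentSpace (𝓡 m) x) :
      (inner ℝ (F x v) w : ℝ) = inner ℝ v (F x w) := by
    simp only [hF, inner_add_left, inner_add_right, inner_smul_left, inner_smul_right, hJ.symm,
      RCLike.conj_to_real]
  have hFP (x : M) (v : TangentSpace (𝓡 m) x) :=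
    (hF x v).trans (metallic_comb_eq hpq a b x v)
  have hlk := metallic_eigenvalue_mul hpq hab
  have hcurv := curv_eq hnabla hFsymm hR
  have hrank2 (y : M) : 2 ≤ Module.finrank ℝ (distD p q J y) := (hrank y).symm ▸ hn
  have hc : 0 ≤ c := by
    by_cases hc0 : c = 0
    · exact hc0.ge
    obtain ⟨v, hv, hvv, -⟩ := exists_unit_mem_inner_eq_zero (hrank2 x) 0
    obtain ⟨w, hw, hww, hwv⟩ := exists_unit_mem_inner_eq_zero (hrank2 x) v
    obtain ⟨u, hu⟩ : ∃ u, u ∉ distD p q J x := by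
      by_contra! h
      have h1 := hrank x
      rw [(Submodule.eq_top_iff').2 h, finrank_top] at h1
      have h2 : Module.finrank ℝ (TangentSpace (𝓡 m) x) = m := finrank_euclideanSpace_fin
      omega
    refine nonneg_of_curv_eq hP hnabla hinv hFs hFP hlk hc0 hcurv (fun y z _ => ?_)
      ((mem_distD hpq).1 hw) ((mem_distD hpq).1 hv) (u := u - projP p q J x u) ?_ hww hvv hwv ?_
    · obtain ⟨t, ht, ht0, htz⟩ := exists_mem_ne_zero_inner_eq_zero (hrank2 y) z
      exact ⟨t, (mem_distD hpq).1 ht, ht0, htz⟩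
    · rw [map_sub, hP.idem, sub_self]
    · exact fun h => hu ((mem_distD hpq).2 (sub_eq_zero.1 h).symm)
  set l := a * sigmaMinus p q + b
  have gauss (u v : distD p q J x) : riemannD p q J nabla x u v v u
      = c * l ^ 2 * (inner ℝ u u * inner ℝ v v - inner ℝ u v ^ 2)
        + (inner ℝ (secondFFBilin hpq hJ hnabla x u u) (secondFFBilin hpq hJ hnabla x v v)
          - ‖secondFFBilin hpq hJ hnabla x u v‖ ^ 2) := by
    obtain ⟨X, hX, hXx, hXe⟩ := exists_tangent_eventuallyEq_extendD hpq hJ u.2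
    obtain ⟨Y, hY, hYx, hYe⟩ := exists_tangent_eventuallyEq_extendD hpq hJ v.2
    rw [← hXx] at hXe
    rw [← hYx] at hYe
    have hFl {Z : VField (𝓡 m) M} (hZ : IsTangent (projP p q J) Z) : F x (Z x) = l • Z x := by
      rw [hFP, hZ x, sub_self, smul_zero, add_zero]
    have h := riemannD_eq hpq hJ hnabla hX hY hY hX hXe hYe hYe
    rw [hcurv, hFl hX, hFl hY, secondFF_symm hpq hJ hnabla hinv
      ((mem_distD hpq).2 (hY x)) ((mem_distD hpq).2 (hX x)), real_inner_self_eq_norm_sq,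
      hXx, hYx] at h
    rw [h]
    simp only [secondFFBilin_apply, Submodule.coe_inner, inner_smul_left, inner_sub_left,
      RCLike.conj_to_real]
    rw [real_inner_comm (secondFF p q J nabla x u u), real_inner_comm (u : TangentSpace (𝓡 m) x) v]
    ring
  have hn' : (2 : ℝ) ≤ n := by exact_mod_cast hn
  have : FiniteDimensional ℝ (TangentSpace (𝓡 m) x) :=
    inferInstanceAs (FiniteDimensional ℝ (EuclideanSpace ℝ (Fin m)))
  have hH : (n : ℝ) ^ 2 * ((n : ℝ) - 2) / (2 * ((n : ℝ) - 1))
        * ‖meanCurvature p q J nabla x‖ ^ 2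
      = ((n : ℝ) - 2) / (2 * ((n : ℝ) - 1))
        * ‖∑ i, secondFFBilin hpq hJ hnabla x (stdOrthonormalBasis ℝ (distD p q J x) i)
            (stdOrthonormalBasis ℝ (distD p q J x) i)‖ ^ 2 := by
    simp only [meanCurvature, hrank, norm_smul, secondFFBilin_apply, mul_pow]
    rw [Real.norm_eq_abs, sq_abs]
    have h0 : (n : ℝ) ≠ 0 := by linarith
    field_simp
  have key : scalarD p q J nabla x
      - (c * l ^ 2 * ((n : ℝ) ^ 2 - n + 2) / 2
        + (n : ℝ) ^ 2 * ((n : ℝ) - 2) / (2 * ((n : ℝ) - 1))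
          * ‖meanCurvature p q J nabla x‖ ^ 2)
      ≤ sInf {k : ℝ | ∃ u ∈ distD p q J x, ∃ v ∈ distD p q J x,
        LinearIndependent ℝ ![u, v] ∧ k = sectionalD p q J nabla x u v} := by
    refine le_csInf ?_ ?_
    · obtain ⟨v, hv, hvv, -⟩ := exists_unit_mem_inner_eq_zero (hrank2 x) 0
      obtain ⟨w, hw, hww, hwv⟩ := exists_unit_mem_inner_eq_zero (hrank2 x) v
      refine ⟨_, v, hv, w, hw, LinearIndependent.pair_iff.2 fun s t hst => ?_, rfl⟩
      have h1 := congrArg (fun z => (inner ℝ v z : ℝ)) hst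
      have h2 := congrArg (fun z => (inner ℝ w z : ℝ)) hst
      simp only [inner_add_right, inner_smul_right, hvv, hww, hwv, real_inner_comm w v,
        inner_zero_right] at h1 h2
      exact ⟨by linarith, by linarith⟩
    · rintro k ⟨u, hu, v, hv, huv, rfl⟩
      have huv' : LinearIndependent ℝ ![(⟨u, hu⟩ : distD p q J x), ⟨v, hv⟩] := by
        refine LinearIndependent.of_comp (distD p q J x).subtype ?_
        convert huv using 1
        ext i
        fin_cases i <;> rfl
      have h := chen_algebraic hn (hrank x)
        (Rm := fun u v w z : distD p q J x => riemannD p q J nabla x u v w z)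
        (secondFFBilin hpq hJ hnabla x)
        (fun u v => secondFF_symm hpq hJ hnabla hinv u.2 v.2) gauss
        (stdOrthonormalBasis ℝ (distD p q J x)) huv'
      -- the constant `n² - n - 2` is replaced by `n² - n + 2`, at the price `0 ≤ c`
      rw [hH]
      have hκ : 0 ≤ c * l ^ 2 := mul_nonneg hc (sq_nonneg l)
      change scalarD p q J nabla x - sectionalD p q J nabla x u v ≤ _ at h
      linarith
  rw [chenInvariant]
  linarith
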